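/- Let $q$ be transcendental over $\mathbb Q$, $K=\mathbb Q(q)$, $r\ge 1$, $m\ge 2$. For $k\ge 1$ let $\mathbb I_{2k}=\{-k+\frac12,\dots,-\frac12,\frac12,\dots,k-\frac12\}$. Let $\underline V$ be the $K$-vector space with basis $\{\eta_a\mid a\in\mathbb I_{2r+4}\}$ and $V\subset\underline V$ the span of the $\eta_a$ with $a\in\mathbb I_{2r+2}$. For a tuple $f=(f(1),\dots,f(n))$ of indices write $M_f=\eta_{f(1)}\otimes\cdots\otimes\eta_{f(n)}$. **Hecke algebra.** $\mathcal H(B_n)$ is the $K$-algebra generated by $H_0,\dots,H_{n-1}$ with relations $(H_i-q^{-1})(H_i+q)=0$; $H_iH_{i+1}H_i=H_{i+1}H_iH_{i+1}$ for $1\le i\le n-2$; $H_iH_j=H_jH_i$ for $|i-j|>1$; $H_0H_1H_0H_1=H_1H_0H_1H_0$. It acts from the right on $V^{\otimes n}$ and on $\underline V^{\otimes n}$ by the rules: for $i>0$, with $fs_i$ the tuple $f$ with the entries $f(i),f(i+1)$ exchanged, $M_fH_i$ is $q^{-1}M_f$ if $f(i)=f(i+1)$, $M_{fs_i}$ if $f(i)<f(i+1)$,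 and $M_{fs_i}+(q^{-1}-q)M_f$ if $f(i)>f(i+1)$; and, with $fs_0=(-f(1),f(2),\dots,f(n))$, $M_fH_0$ is $M_{fs_0}$ if $f(1)>0$, and $M_{fs_0}+(q^{-1}-q)M_f$ if $f(1)<0$. For $\sigma\in\mathfrak S_n$ with reduced expression $\sigma=s_{i_1}\cdots s_{i_k}$ put $H_\sigma=H_{i_1}\cdots H_{i_k}$. **Duplex Hecke algebra.** $\mathcal H_m$ is the $K$-algebra generated by $T_0,\dots,T_{m-1}$ and $x^{(l)}_\sigma$ ($0\le l\le m$, $\sigma\in\mathfrak S_l$) with the following relations: the $T_i$ satisfy the relations of the $H_i$ in $\mathcal H(B_m)$; for $0<i<l$, $x^{(l)}_\sigma x^{(l)}_{s_i}$ equals $x^{(l)}_{\sigma s_i}$ if $\ell(\sigma s_i)=\ell(\sigma)+1$ and $x^{(l)}_{\sigma s_i}+(q^{-1}-q)x^{(l)}_\sigma$ if $\ell(\sigma s_i)=\ell(\sigma)-1$; likewise $x^{(l)}_{s_i}x^{(l)}_\sigma$ equals $x^{(l)}_{s_i\sigma}$ if $\ell(s_i\sigma)=\ell(\sigma)+1$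 and $x^{(l)}_{s_i\sigma}+(q^{-1}-q)x^{(l)}_\sigma$ if $\ell(s_i\sigma)=\ell(\sigma)-1$; $x^{(l)}_\sigma x^{(k)}_\gamma=0$ for $l\ne k$; $T_ix^{(l)}_\sigma=x^{(l)}_{s_i}x^{(l)}_\sigma$ and $x^{(l)}_\sigma T_i=x^{(l)}_\sigma x^{(l)}_{s_i}$ for $0<i<l$; and $T_ix^{(l)}_\sigma=q^{-1}x^{(l)}_\sigma=x^{(l)}_\sigma T_i$ for $i>l$. It acts from the right on $\underline V^{\otimes m}$ by an anti-homomorphism $\Xi:\mathcal H_m\to\mathrm{End}_K(\underline V^{\otimes m})$: $T_i$ acts as $H_i$; $x^{(l)}_\sigma$ acts on $V^{\otimes l}\otimes\eta_{r+3/2}^{\otimes(m-l)}$ as $H_\sigma\in\mathcal H(B_l)$ on $V^{\otimes l}$ tensored with the identity, and kills every other basis vector $M_f$. **The modules $D^\pi_l$.** For disjoint $I,J\subset\{1,\dots,m\}$ let $\underline V^{\otimes m}_{I,J}$ be the span of the $M_f$ with $f(k)\in\mathbb I_{2r+2}$ for $k\in I$, $f(k)=-r-\frac32$ for $k\in J$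 and $f(k)=r+\frac32$ for the other $k$. For $0\le l\le m$: 1. $V^{\otimes l}$ is a direct sum $\bigoplus_{\pi\in I_l}S^\pi$ of finitely many irreducible $\mathcal H(B_l)$-submodules; 2. for all disjoint $I,J$ with $\#I=l$ there is a product $\omega_{I,J}$ of elements $T_i^{\pm1}$ of $\mathcal H_m$ with $\Xi(\omega_{I,J})(\underline V^{\otimes m}_{I,J})=\underline V^{\otimes m}_{\{1,\dots,l\},\emptyset}=V^{\otimes l}\otimes\eta_{r+3/2}^{\otimes(m-l)}$. Fix, for every $l$, any decomposition of $V^{\otimes l}$ as a direct sum of irreducible submodules $S^\pi$ ($\pi\in I_l$) and any such elements $\omega_{I,J}$, and put $$D^\pi_l=\sum_{\#I=l,\ J\cap I=\emptyset}\Xi(\omega_{I,J}^{-1})\bigl(S^\pi\otimes\eta_{r+3/2}^{\otimes(m-l)}\bigr).$$ **Claim.** Statements 1 and 2 hold; $\underline V^{\otimes m}$ is a completely reducible $\mathcal H_m$-module; the sum that defines $D^\pi_l$ is direct, each $D^\pi_l$ is an irreducible $\mathcal H_m$-submodule, and $$\underline V^{\otimes m}=\bigoplus_{l=0}^m\bigoplus_{\pi\in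 I_l}D^\pi_l .$$ -/

import Mathlib

namespace DuplexB

/-- `simpleRefl l j` (`0 ≤ j < l - 1`) is the simple transposition `s_{j+1}` of the symmetric group
`𝔖_l`: as `Fin l` is numbered from `0`, it exchanges the entries numbered `j` and `j + 1`. -/
def simpleRefl (l : ℕ) (j : Fin (l - 1)) : Equiv.Perm (Fin l) :=
  Equiv.swap ⟨j, by omega⟩ ⟨j + 1, by omega⟩

/-- The Coxeter length of a permutation: its number of inversions. -/
def len {l : ℕ} (σ : Equiv.Perm (Fin l)) : ℕ :=
  (Finset.univ.filter fun p : Fin l × Fin l => p.1 < p.2 ∧ σ p.2 < σ p.1).card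

theorem simpleRefl_mul_self {l : ℕ} (j : Fin (l - 1)) : simpleRefl l j * simpleRefl l j = 1 :=
  Equiv.swap_mul_self _ _

theorem simpleRefl_val {l : ℕ} (j : Fin (l - 1)) (a : Fin l) :
    ((simpleRefl l j a : Fin l) : ℕ) =
      if (a : ℕ) = j then (j : ℕ) + 1 else if (a : ℕ) = j + 1 then (j : ℕ) else a := by
  unfold simpleRefl
  rw [Equiv.swap_apply_def]
  simp only [Fin.ext_iff]
  split_ifs <;> rfl

theorem swap_braid {α : Type*} [DecidableEq α] {x y z : α} (hxy : x ≠ y) (hxz : x ≠ z)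
    (hyz : y ≠ z) : Equiv.swap x y * Equiv.swap y z * Equiv.swap x y =
      Equiv.swap y z * Equiv.swap x y * Equiv.swap y z := by
  rw [Equiv.swap_mul_swap_mul_swap hxy hxz, Equiv.swap_comm x y, Equiv.swap_comm y z,
    Equiv.swap_mul_swap_mul_swap hyz.symm hxz.symm, Equiv.swap_comm]

theorem simpleRefl_braid {l : ℕ} (i j : Fin (l - 1)) (hij : (j : ℕ) = i + 1) :
    simpleRefl l i * simpleRefl l j * simpleRefl l i =
      simpleRefl l j * simpleRefl l i * simpleRefl l j := by
  unfold simpleRefl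
  have e : (⟨i + 1, by omega⟩ : Fin l) = ⟨j, by omega⟩ := Fin.ext hij.symm
  rw [e]
  exact swap_braid (by simp only [ne_eq, Fin.mk.injEq]; omega)
    (by simp only [ne_eq, Fin.mk.injEq]; omega) (by simp only [ne_eq, Fin.mk.injEq]; omega)

theorem len_mul_of_lt {l : ℕ} (σ : Equiv.Perm (Fin l)) (j : Fin (l - 1))
    (h : σ ⟨j, by omega⟩ < σ ⟨j + 1, by omega⟩) : len (σ * simpleRefl l j) = len σ + 1 := by
  classical
  set s := simpleRefl l j with hs
  have hss : ∀ a, s (s a) = a := fun a => by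
    rw [← Equiv.Perm.mul_apply, hs, simpleRefl_mul_self, Equiv.Perm.one_apply]
  have hv := simpleRefl_val j
  rw [← hs] at hv
  have hja : s ⟨j, by omega⟩ = ⟨j + 1, by omega⟩ := Fin.ext (by rw [hv]; simp)
  have hjb : s ⟨j + 1, by omega⟩ = ⟨j, by omega⟩ := Fin.ext (by rw [hv]; simp)
  have hmono : ∀ a b : Fin l, a < b → ¬ ((a : ℕ) = j ∧ (b : ℕ) = j + 1) → s a < s b := by
    intro a b hab hne
    rw [Fin.lt_def, hv, hv]
    rw [Fin.lt_def] at hab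
    split_ifs <;> omega
  have key : (Finset.univ.filter fun p : Fin l × Fin l =>
        p.1 < p.2 ∧ (σ * s) p.2 < (σ * s) p.1) =
      insert (⟨⟨j, by omega⟩, ⟨j + 1, by omega⟩⟩ : Fin l × Fin l)
        ((Finset.univ.filter fun p : Fin l × Fin l => p.1 < p.2 ∧ σ p.2 < σ p.1).image
          fun p => (s p.1, s p.2)) := by
    ext ⟨a, b⟩
    rw [Finset.mem_filter, Finset.mem_insert, Finset.mem_image]
    simp only [Finset.mem_filter, Finset.mem_univ, true_and, Prod.mk.injEq, Prod.exists]
    constructor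
    · rintro ⟨hab, hσ⟩
      rw [Equiv.Perm.mul_apply, Equiv.Perm.mul_apply] at hσ
      by_cases hc : (a : ℕ) = j ∧ (b : ℕ) = j + 1
      · exact Or.inl ⟨Fin.ext hc.1, Fin.ext hc.2⟩
      · exact Or.inr ⟨s a, s b, ⟨hmono a b hab hc, hσ⟩, hss a, hss b⟩
    · rintro (⟨rfl, rfl⟩ | ⟨c, d, ⟨hcd, hσ⟩, rfl, rfl⟩)
      · refine ⟨by simp [Fin.lt_def], ?_⟩
        rw [Equiv.Perm.mul_apply, Equiv.Perm.mul_apply, hja, hjb]; exact h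
      · rw [Equiv.Perm.mul_apply, Equiv.Perm.mul_apply, hss, hss]
        refine ⟨hmono c d hcd ?_, hσ⟩
        rintro ⟨h1, h2⟩
        have e1 : c = ⟨j, by omega⟩ := Fin.ext h1
        have e2 : d = ⟨j + 1, by omega⟩ := Fin.ext h2
        have k1 := congrArg (fun a => (σ a : ℕ)) e1
        have k2 := congrArg (fun a => (σ a : ℕ)) e2
        rw [Fin.lt_def] at hσ h
        omega
  unfold len
  rw [key, Finset.card_insert_of_notMem, Finset.card_image_of_injective]
  · rintro ⟨a, b⟩ ⟨c, d⟩ he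
    simp only [Prod.mk.injEq, EmbeddingLike.apply_eq_iff_eq] at he
    exact Prod.ext he.1 he.2
  · simp only [Finset.mem_image, Finset.mem_filter, Finset.mem_univ, true_and, Prod.mk.injEq,
      Prod.exists, not_exists, not_and]
    rintro c d ⟨hcd, -⟩ h1 h2
    have e1 : c = ⟨j + 1, by omega⟩ := (hss c).symm.trans ((congrArg s h1).trans hja)
    have e2 : d = ⟨j, by omega⟩ := (hss d).symm.trans ((congrArg s h2).trans hjb)
    have k1 := congrArg Fin.val e1
    have k2 := congrArg Fin.val e2
    rw [Fin.lt_def] at hcd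
    dsimp only at k1 k2
    omega

theorem mul_simpleRefl_cancel {l : ℕ} (σ : Equiv.Perm (Fin l)) (j : Fin (l - 1)) :
    σ * simpleRefl l j * simpleRefl l j = σ := by
  rw [mul_assoc, simpleRefl_mul_self, mul_one]

theorem simpleRefl_left {l : ℕ} (j : Fin (l - 1)) :
    simpleRefl l j ⟨j, by omega⟩ = ⟨j + 1, by omega⟩ := Equiv.swap_apply_left _ _

theorem simpleRefl_right {l : ℕ} (j : Fin (l - 1)) :
    simpleRefl l j ⟨j + 1, by omega⟩ = ⟨j, by omega⟩ := Equiv.swap_apply_right _ _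

theorem len_mul_of_gt {l : ℕ} (σ : Equiv.Perm (Fin l)) (j : Fin (l - 1))
    (h : σ ⟨j + 1, by omega⟩ < σ ⟨j, by omega⟩) : len σ = len (σ * simpleRefl l j) + 1 := by
  have := len_mul_of_lt (σ * simpleRefl l j) j (by
    rw [Equiv.Perm.mul_apply, Equiv.Perm.mul_apply, simpleRefl_left, simpleRefl_right]; exact h)
  rwa [mul_simpleRefl_cancel] at this

theorem lt_or_gt {l : ℕ} (σ : Equiv.Perm (Fin l)) (j : Fin (l - 1)) :
    σ ⟨j, by omega⟩ < σ ⟨j + 1, by omega⟩ ∨ σ ⟨j + 1, by omega⟩ < σ ⟨j, by omega⟩ := by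
  apply lt_or_gt_of_ne
  intro h
  have := congrArg Fin.val (σ.injective h)
  simp at this

theorem gt_iff_len {l : ℕ} (σ : Equiv.Perm (Fin l)) (j : Fin (l - 1)) :
    σ ⟨j + 1, by omega⟩ < σ ⟨j, by omega⟩ ↔ len σ = len (σ * simpleRefl l j) + 1 := by
  refine ⟨len_mul_of_gt σ j, fun h => ?_⟩
  rcases lt_or_gt σ j with h1 | h1
  · have := len_mul_of_lt σ j h1
    omega
  · exact h1

theorem len_inv {l : ℕ} (σ : Equiv.Perm (Fin l)) : len σ⁻¹ = len σ := by
  unfold len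
  refine Finset.card_bij' (fun p _ => (σ⁻¹ p.2, σ⁻¹ p.1)) (fun p _ => (σ p.2, σ p.1)) ?_ ?_ ?_ ?_
  · rintro ⟨a, b⟩ h
    simp only [Finset.mem_filter, Finset.mem_univ, true_and] at h ⊢
    simpa using ⟨h.2, h.1⟩
  · rintro ⟨a, b⟩ h
    simp only [Finset.mem_filter, Finset.mem_univ, true_and] at h ⊢
    simpa using ⟨h.2, h.1⟩
  · rintro ⟨a, b⟩ h
    simp
  · rintro ⟨a, b⟩ h
    simp

theorem simpleRefl_inv {l : ℕ} (j : Fin (l - 1)) : (simpleRefl l j)⁻¹ = simpleRefl l j :=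
  inv_eq_of_mul_eq_one_left (simpleRefl_mul_self j)

theorem len_mul_cases {l : ℕ} (σ : Equiv.Perm (Fin l)) (j : Fin (l - 1)) :
    len (σ * simpleRefl l j) = len σ + 1 ∨ len σ = len (σ * simpleRefl l j) + 1 :=
  (lt_or_gt σ j).imp (len_mul_of_lt σ j) (len_mul_of_gt σ j)

theorem len_simpleRefl_mul_cases {l : ℕ} (σ : Equiv.Perm (Fin l)) (j : Fin (l - 1)) :
    len (simpleRefl l j * σ) = len σ + 1 ∨ len σ = len (simpleRefl l j * σ) + 1 := by
  have := len_mul_cases σ⁻¹ j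
  rwa [len_inv, ← len_inv (σ⁻¹ * simpleRefl l j), mul_inv_rev, simpleRefl_inv, inv_inv] at this

theorem len_one {l : ℕ} : len (1 : Equiv.Perm (Fin l)) = 0 := by
  unfold len
  rw [Finset.card_eq_zero, Finset.filter_eq_empty_iff]
  rintro ⟨a, b⟩ - ⟨h1, h2⟩
  exact absurd h1 (not_lt.2 (le_of_lt h2))

theorem exists_descent {l : ℕ} (σ : Equiv.Perm (Fin l)) (h : σ ≠ 1) :
    ∃ j : Fin (l - 1), len σ = len (σ * simpleRefl l j) + 1 := by
  by_contra hc
  push Not at hc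
  apply h
  have hm : StrictMono σ := by
    cases l with
    | zero => intro a; exact a.elim0
    | succ n =>
      rw [Fin.strictMono_iff_lt_succ]
      intro i
      rcases lt_or_gt σ (⟨i, by omega⟩ : Fin (n + 1 - 1)) with h1 | h1
      · exact h1
      · exact absurd (len_mul_of_gt σ _ h1) (hc _)
  have hid : ∀ a, σ a = a := by
    intro a
    exact congrFun (hm.range_inj strictMono_id |>.1 (by
      rw [Set.range_id]; exact σ.surjective.range_eq)) a
  exact Equiv.ext hid

/-- A reduced word of `σ`: the word `[j₁, …, j_k]` stands for `s_{j₁+1} ⋯ s_{j_k+1}`. -/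
def IsReducedWord {l : ℕ} (σ : Equiv.Perm (Fin l)) (w : List (Fin (l - 1))) : Prop :=
  (w.map (simpleRefl l)).prod = σ ∧ w.length = len σ

theorem exists_reducedWord {l : ℕ} (σ : Equiv.Perm (Fin l)) : ∃ w, IsReducedWord σ w := by
  induction hn : len σ generalizing σ with
  | zero =>
    by_cases h : σ = 1
    · exact ⟨[], by simp [IsReducedWord, h, len_one]⟩
    · obtain ⟨j, hj⟩ := exists_descent σ h
      omega
  | succ n ih =>
    obtain ⟨j, hj⟩ := exists_descent σ (by rintro rfl; rw [len_one] at hn; omega)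
    obtain ⟨w, hw, hl⟩ := ih (σ * simpleRefl l j) (by omega)
    refine ⟨w ++ [j], ?_, ?_⟩
    · rw [List.map_append, List.prod_append, hw]
      simp [mul_simpleRefl_cancel]
    · simp; omega

theorem len_le_length {l : ℕ} (w : List (Fin (l - 1))) :
    len (w.map (simpleRefl l)).prod ≤ w.length := by
  induction w using List.reverseRecOn with
  | nil => simp [len_one]
  | append_singleton w j ih =>
    rw [List.map_append, List.prod_append]
    simp only [List.map_cons, List.map_nil, List.prod_cons, List.prod_nil, mul_one,
      List.length_append, List.length_cons, List.length_nil]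
    have := len_mul_cases (w.map (simpleRefl l)).prod j
    omega

theorem IsReducedWord.append {l : ℕ} {σ : Equiv.Perm (Fin l)} {w : List (Fin (l - 1))}
    {j : Fin (l - 1)} (h : IsReducedWord (σ * simpleRefl l j) w)
    (hj : len σ = len (σ * simpleRefl l j) + 1) : IsReducedWord σ (w ++ [j]) := by
  refine ⟨?_, ?_⟩
  · rw [List.map_append, List.prod_append, h.1]
    simp [mul_simpleRefl_cancel]
  · simp [h.2]; omega

theorem IsReducedWord.of_append {l : ℕ} {σ : Equiv.Perm (Fin l)} {w : List (Fin (l - 1))}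
    {j : Fin (l - 1)} (h : IsReducedWord σ (w ++ [j])) :
    IsReducedWord (σ * simpleRefl l j) w ∧ len σ = len (σ * simpleRefl l j) + 1 := by
  obtain ⟨h1, h2⟩ := h
  have e : (w.map (simpleRefl l)).prod = σ * simpleRefl l j := by
    rw [← h1, List.map_append, List.prod_append]
    simp [mul_simpleRefl_cancel]
  have h3 := len_le_length w
  rw [e] at h3
  have h4 := len_mul_cases σ j
  simp at h2
  exact ⟨⟨e, by omega⟩, by omega⟩

/-- Any two reduced words of a permutation have the same product in a monoid in which the letters
satisfy the braid relations of type A. -/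
theorem reducedWord_prod_eq {A : Type*} [Monoid A] {l : ℕ} (g : Fin (l - 1) → A)
    (hbraid : ∀ i j : Fin (l - 1), (j : ℕ) = i + 1 → g i * g j * g i = g j * g i * g j)
    (hcomm : ∀ i j : Fin (l - 1), (i : ℕ) + 1 < j → g i * g j = g j * g i)
    (σ : Equiv.Perm (Fin l)) (w w' : List (Fin (l - 1))) (hw : IsReducedWord σ w)
    (hw' : IsReducedWord σ w') : (w.map g).prod = (w'.map g).prod := by
  induction hn : len σ using Nat.strong_induction_on generalizing σ w w' with
  | _ n ih =>
  subst hn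
  rcases List.eq_nil_or_concat w with rfl | ⟨u, i, rfl⟩
  · have h0 : w' = [] := by
      rw [← List.length_eq_zero_iff, hw'.2, ← hw.2]; rfl
    rw [h0]
  rcases List.eq_nil_or_concat w' with rfl | ⟨u', j, rfl⟩
  · have := hw.2
    rw [← hw'.2] at this
    simp at this
  rw [List.concat_eq_append] at hw hw' ⊢
  rw [List.concat_eq_append]
  obtain ⟨hu, hi⟩ := hw.of_append
  obtain ⟨hu', hj⟩ := hw'.of_append
  have hi' := (gt_iff_len σ i).2 hi
  have hj' := (gt_iff_len σ j).2 hj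
  simp only [List.map_append, List.prod_append, List.map_cons, List.map_nil, List.prod_cons,
    List.prod_nil, mul_one]
  have hcase1 : ∀ (i j : Fin (l - 1)) (u u' : List (Fin (l - 1))),
      IsReducedWord (σ * simpleRefl l i) u → IsReducedWord (σ * simpleRefl l j) u' →
      len σ = len (σ * simpleRefl l i) + 1 → len σ = len (σ * simpleRefl l j) + 1 →
      (i : ℕ) + 1 < j → (u.map g).prod * g i = (u'.map g).prod * g j := by
    intro i j u u' hu hu' hi hj hij
    have hj' := (gt_iff_len σ j).2 hj
    have hc : simpleRefl l i * simpleRefl l j = simpleRefl l j * simpleRefl l i := by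
      ext a
      simp only [Equiv.Perm.mul_apply, simpleRefl_val]
      split_ifs <;> omega
    have e1 : len (σ * simpleRefl l i) = len (σ * simpleRefl l i * simpleRefl l j) + 1 := by
      apply len_mul_of_gt
      rw [Equiv.Perm.mul_apply, Equiv.Perm.mul_apply]
      convert hj' using 2 <;> (apply Fin.ext; rw [simpleRefl_val]; dsimp only; split_ifs <;> omega)
    obtain ⟨v, hv⟩ := exists_reducedWord (σ * simpleRefl l i * simpleRefl l j)
    have hvj := hv.append e1
    rw [mul_assoc, hc, ← mul_assoc] at hv
    rw [mul_assoc, hc, ← mul_assoc] at e1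
    have hvi := hv.append (by omega)
    rw [ih _ (by omega) _ u _ hu hvj rfl, ih _ (by omega) _ u' _ hu' hvi rfl]
    simp only [List.map_append, List.prod_append, List.map_cons, List.map_nil, List.prod_cons,
      List.prod_nil, mul_one]
    rw [mul_assoc, mul_assoc, hcomm i j hij]
  have hcase2 : ∀ (i j : Fin (l - 1)) (u u' : List (Fin (l - 1))),
      IsReducedWord (σ * simpleRefl l i) u → IsReducedWord (σ * simpleRefl l j) u' →
      len σ = len (σ * simpleRefl l i) + 1 → len σ = len (σ * simpleRefl l j) + 1 →
      (j : ℕ) = i + 1 → (u.map g).prod * g i = (u'.map g).prod * g j := by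
    intro i j u u' hu hu' hi hj hij
    have hi' := (gt_iff_len σ i).2 hi
    have hj' := (gt_iff_len σ j).2 hj
    have hc : simpleRefl l i * simpleRefl l j * simpleRefl l i =
        simpleRefl l j * simpleRefl l i * simpleRefl l j := simpleRefl_braid i j hij
    have p1 : (⟨i + 1, by omega⟩ : Fin l) = ⟨j, by omega⟩ := Fin.ext hij.symm
    have a1 : simpleRefl l i ⟨j + 1, by omega⟩ = ⟨j + 1, by omega⟩ := by
      apply Fin.ext; rw [simpleRefl_val]; dsimp only; split_ifs <;> omega
    have a2 : simpleRefl l i ⟨j, by omega⟩ = ⟨i, by omega⟩ := by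
      rw [← p1]; exact simpleRefl_right i
    have a3 : simpleRefl l j ⟨i, by omega⟩ = ⟨i, by omega⟩ := by
      apply Fin.ext; rw [simpleRefl_val]; dsimp only; split_ifs <;> omega
    have a4 : simpleRefl l j ⟨i + 1, by omega⟩ = ⟨j + 1, by omega⟩ := by
      rw [p1]; exact simpleRefl_left j
    have e1 : len (σ * simpleRefl l i) = len (σ * simpleRefl l i * simpleRefl l j) + 1 := by
      apply len_mul_of_gt
      rw [Equiv.Perm.mul_apply, Equiv.Perm.mul_apply, a1, a2]
      rw [p1] at hi'
      exact hj'.trans hi'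
    have e2 : len (σ * simpleRefl l i * simpleRefl l j) =
        len (σ * simpleRefl l i * simpleRefl l j * simpleRefl l i) + 1 := by
      apply len_mul_of_gt
      simp only [Equiv.Perm.mul_apply]
      rw [a3, a4, a1, simpleRefl_left i, p1]
      exact hj'
    have e3 : σ * simpleRefl l i * simpleRefl l j * simpleRefl l i =
        σ * simpleRefl l j * simpleRefl l i * simpleRefl l j := by
      rw [mul_assoc, mul_assoc, ← mul_assoc (simpleRefl l i), hc]
      simp only [mul_assoc]
    obtain ⟨v, hv⟩ := exists_reducedWord (σ * simpleRefl l i * simpleRefl l j * simpleRefl l i)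
    have hvj := (hv.append e2).append e1
    rw [e3] at hv
    have f1 := len_mul_cases (σ * simpleRefl l j) i
    have f2 := len_mul_cases (σ * simpleRefl l j * simpleRefl l i) j
    rw [← e3] at f2
    have f3 : len (σ * simpleRefl l j * simpleRefl l i) =
        len (σ * simpleRefl l j * simpleRefl l i * simpleRefl l j) + 1 := by
      rw [← e3]; omega
    have hvi := (hv.append f3).append (by omega)
    rw [ih _ (by omega) _ u _ hu hvj rfl, ih _ (by omega) _ u' _ hu' hvi rfl]
    simp only [List.map_append, List.prod_append, List.map_cons, List.map_nil, List.prod_cons,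
      List.prod_nil, mul_one]
    have := hbraid i j hij
    rw [mul_assoc, mul_assoc, ← mul_assoc (g i), this]
    simp only [mul_assoc]
  rcases lt_trichotomy (i : ℕ) j with hij | hij | hij
  · by_cases h : (i : ℕ) + 1 < j
    · exact hcase1 i j u u' hu hu' hi hj h
    · exact hcase2 i j u u' hu hu' hi hj (by omega)
  · have hij : i = j := Fin.ext hij
    subst hij
    rw [ih _ (by omega) _ u u' hu hu' rfl]
  · by_cases h : (j : ℕ) + 1 < i
    · exact (hcase1 j i u' u hu' hu hj hi h).symm
    · exact (hcase2 j i u' u hu' hu hj hi (by omega)).symm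


noncomputable section

open scoped TensorProduct
open MulOpposite

/-! ### The Hecke algebra of type B -/

/-- Relations of the Iwahori-Hecke algebra of type `B_l` with generators `H_0, …, H_{l-1}`. -/
inductive HeckeRel {K : Type*} [Field K] (q : Kˣ) (l : ℕ) :
    FreeAlgebra K (Fin l) → FreeAlgebra K (Fin l) → Prop
  | quadratic (i : Fin l) : HeckeRel q l
      ((FreeAlgebra.ι K i - algebraMap K _ (q : K)⁻¹) * (FreeAlgebra.ι K i + algebraMap K _ (q : K)))
      0
  | braid (i j : Fin l) (hi : 0 < (i : ℕ)) (hij : (j : ℕ) = i + 1) : HeckeRel q l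
      (FreeAlgebra.ι K i * FreeAlgebra.ι K j * FreeAlgebra.ι K i)
      (FreeAlgebra.ι K j * FreeAlgebra.ι K i * FreeAlgebra.ι K j)
  | comm (i j : Fin l) (hij : (i : ℕ) + 1 < j) : HeckeRel q l
      (FreeAlgebra.ι K i * FreeAlgebra.ι K j) (FreeAlgebra.ι K j * FreeAlgebra.ι K i)
  | braidB (i j : Fin l) (hi : (i : ℕ) = 0) (hj : (j : ℕ) = 1) : HeckeRel q l
      (FreeAlgebra.ι K i * FreeAlgebra.ι K j * FreeAlgebra.ι K i * FreeAlgebra.ι K j)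
      (FreeAlgebra.ι K j * FreeAlgebra.ι K i * FreeAlgebra.ι K j * FreeAlgebra.ι K i)

/-- The Iwahori-Hecke algebra `𝓗(B_l)`. -/
def HeckeB {K : Type*} [Field K] (q : Kˣ) (l : ℕ) : Type _ := RingQuot (HeckeRel q l)

instance {K : Type*} [Field K] (q : Kˣ) (l : ℕ) : Ring (HeckeB q l) :=
  inferInstanceAs (Ring (RingQuot (HeckeRel q l)))

instance {K : Type*} [Field K] (q : Kˣ) (l : ℕ) : Algebra K (HeckeB q l) :=
  inferInstanceAs (Algebra K (RingQuot (HeckeRel q l)))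

/-- The quotient map from the free algebra. -/
def HeckeB.mk {K : Type*} [Field K] (q : Kˣ) (l : ℕ) : FreeAlgebra K (Fin l) →ₐ[K] HeckeB q l :=
  RingQuot.mkAlgHom K (HeckeRel q l)

/-- The generator `H_i` of `𝓗(B_l)`. -/
def HeckeB.H {K : Type*} [Field K] (q : Kˣ) {l : ℕ} (i : Fin l) : HeckeB q l :=
  HeckeB.mk q l (FreeAlgebra.ι K i)

namespace HeckeB

variable {K : Type*} [Field K] (q : Kˣ) {l : ℕ}

theorem mk_rel {x y : FreeAlgebra K (Fin l)} (h : HeckeRel q l x y) : mk q l x = mk q l y :=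
  RingQuot.mkAlgHom_rel K h

theorem quadratic (i : Fin l) :
    (H q i - algebraMap K _ (q : K)⁻¹) * (H q i + algebraMap K _ (q : K)) = 0 := by
  have := mk_rel q (HeckeRel.quadratic i)
  simpa only [H, map_mul, map_sub, map_add, map_zero, AlgHom.commutes] using this

theorem braid (i j : Fin l) (hi : 0 < (i : ℕ)) (hij : (j : ℕ) = i + 1) :
    H q i * H q j * H q i = H q j * H q i * H q j := by
  have := mk_rel q (HeckeRel.braid i j hi hij)
  simpa only [H, map_mul] using this

theorem comm (i j : Fin l) (hij : (i : ℕ) + 1 < j) : H q i * H q j = H q j * H q i := by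
  have := mk_rel q (HeckeRel.comm i j hij)
  simpa only [H, map_mul] using this

theorem mul_self (i : Fin l) : H q i * H q i = 1 + ((q : K)⁻¹ - (q : K)) • H q i := by
  have h := quadratic q i
  rw [sub_mul, mul_add, mul_add, ← map_mul, inv_mul_cancel₀ q.ne_zero, map_one,
    ← Algebra.commutes, ← Algebra.smul_def, ← Algebra.smul_def] at h
  rw [sub_smul]
  rw [← sub_eq_zero, ← h]
  abel

/-- `simpleH q j` is `H_{j+1}`, the generator that corresponds to `simpleRefl l j`. -/
def simpleH (j : Fin (l - 1)) : HeckeB q l := H q ⟨j + 1, by omega⟩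

/-- `H_σ = H_{i₁} ⋯ H_{i_k}` for a reduced expression `σ = s_{i₁} ⋯ s_{i_k}`. -/
def perm (σ : Equiv.Perm (Fin l)) : HeckeB q l :=
  ((exists_reducedWord σ).choose.map (simpleH q)).prod

/-- `H_σ` does not depend on the reduced expression. -/
theorem perm_eq {σ : Equiv.Perm (Fin l)} {w : List (Fin (l - 1))} (hw : IsReducedWord σ w) :
    perm q σ = (w.map (simpleH q)).prod :=
  reducedWord_prod_eq (simpleH q)
    (fun _ _ h => braid q _ _ (Nat.succ_pos _) (by simp [h]))
    (fun _ _ h => comm q _ _ (by simpa using h)) σ _ _ (exists_reducedWord σ).choose_spec hw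

theorem perm_mul_up (σ : Equiv.Perm (Fin l)) (j : Fin (l - 1))
    (h : len (σ * simpleRefl l j) = len σ + 1) :
    perm q σ * simpleH q j = perm q (σ * simpleRefl l j) := by
  obtain ⟨w, hw⟩ := exists_reducedWord σ
  have hw' : IsReducedWord (σ * simpleRefl l j) (w ++ [j]) :=
    IsReducedWord.append (by rwa [mul_simpleRefl_cancel]) (by rwa [mul_simpleRefl_cancel])
  rw [perm_eq q hw, perm_eq q hw']
  simp

theorem mul_perm_up (σ : Equiv.Perm (Fin l)) (j : Fin (l - 1))
    (h : len (simpleRefl l j * σ) = len σ + 1) :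
    simpleH q j * perm q σ = perm q (simpleRefl l j * σ) := by
  obtain ⟨w, hw⟩ := exists_reducedWord σ
  have hw' : IsReducedWord (simpleRefl l j * σ) (j :: w) :=
    ⟨by simp [hw.1], by simp [hw.2, h]⟩
  rw [perm_eq q hw, perm_eq q hw']
  simp

theorem perm_mul_down (σ : Equiv.Perm (Fin l)) (j : Fin (l - 1))
    (h : len (σ * simpleRefl l j) + 1 = len σ) :
    perm q σ * simpleH q j =
      perm q (σ * simpleRefl l j) + ((q : K)⁻¹ - (q : K)) • perm q σ := by
  have h1 := perm_mul_up q (σ * simpleRefl l j) j (by rw [mul_simpleRefl_cancel]; omega)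
  rw [mul_simpleRefl_cancel] at h1
  rw [← h1, mul_assoc]
  have h2 : simpleH q j * simpleH q j = 1 + ((q : K)⁻¹ - (q : K)) • simpleH q j := mul_self q _
  rw [h2, mul_add, mul_one, mul_smul_comm]

theorem mul_perm_down (σ : Equiv.Perm (Fin l)) (j : Fin (l - 1))
    (h : len (simpleRefl l j * σ) + 1 = len σ) :
    simpleH q j * perm q σ =
      perm q (simpleRefl l j * σ) + ((q : K)⁻¹ - (q : K)) • perm q σ := by
  have h0 : simpleRefl l j * (simpleRefl l j * σ) = σ := by
    rw [← mul_assoc, simpleRefl_mul_self, one_mul]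
  have h1 := mul_perm_up q (simpleRefl l j * σ) j (by rw [h0]; omega)
  rw [h0] at h1
  rw [← h1, ← mul_assoc]
  have h2 : simpleH q j * simpleH q j = 1 + ((q : K)⁻¹ - (q : K)) • simpleH q j := mul_self q _
  rw [h2, add_mul, one_mul, smul_mul_assoc]

theorem perm_simpleRefl (j : Fin (l - 1)) : perm q (simpleRefl l j) = simpleH q j := by
  have h : len (simpleRefl l j) = 1 := by
    rcases len_mul_cases (1 : Equiv.Perm (Fin l)) j with h | h
    · simpa [len_one] using h
    · simp [len_one] at h
  rw [perm_eq q (w := [j]) ⟨by simp, by simp [h]⟩]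
  simp

end HeckeB

/-! ### Tensor space and the action of the Hecke algebra -/

/-- The index set `{-k + 1/2, …, -1/2, 1/2, …, k - 1/2}` with `2k` elements. The half-integer
`a / 2` is represented by the odd integer `a`, so that order and negation are those of `ℤ`. -/
abbrev HalfInt (k : ℕ) : Type := {a : ℤ // Odd a ∧ |a| < 2 * (k : ℤ)}

/-- The index `-a`. -/
def HalfInt.neg {k : ℕ} (a : HalfInt k) : HalfInt k :=
  ⟨-a.1, a.2.1.neg, by rw [abs_neg]; exact a.2.2⟩

/-- The `m`-th tensor power of the vector space with basis `η_a`, `a ∈ HalfInt k`. For `k = r + 1`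
the vector space is `V`, for `k = r + 2` it is `V̲`. -/
def Tens (K : Type*) [Field K] (k m : ℕ) : Type _ := ⨂[K] _ : Fin m, (HalfInt k →₀ K)

instance (K : Type*) [Field K] (k m : ℕ) : AddCommGroup (Tens K k m) :=
  inferInstanceAs (AddCommGroup (⨂[K] _ : Fin m, (HalfInt k →₀ K)))

instance (K : Type*) [Field K] (k m : ℕ) : Module K (Tens K k m) :=
  inferInstanceAs (Module K (⨂[K] _ : Fin m, (HalfInt k →₀ K)))

/-- The basis `M_f = η_{f(1)} ⊗ ⋯ ⊗ η_{f(m)}` of the tensor power. -/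
def tensBasis (K : Type*) [Field K] (k m : ℕ) :
    Module.Basis (Fin m → HalfInt k) K (Tens K k m) :=
  (Basis.piTensorProduct fun _ => Finsupp.basisSingleOne :
    Module.Basis (Fin m → HalfInt k) K (⨂[K] _ : Fin m, (HalfInt k →₀ K)))

theorem tensBasis_apply (K : Type*) [Field K] (k m : ℕ) (f : Fin m → HalfInt k) :
    tensBasis K k m f =
      (⨂ₜ[K] i, Finsupp.single (f i) (1 : K) : ⨂[K] _ : Fin m, (HalfInt k →₀ K)) :=
  (Basis.piTensorProduct_apply (fun _ : Fin m => Finsupp.basisSingleOne) f).trans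
    (by simp)

section Operators

variable {K : Type*} [Field K] (q : Kˣ) {k m : ℕ}

/-- `f` with the entries at the places `a` and `b` exchanged. -/
def swapAt (a b : Fin m) (f : Fin m → HalfInt k) : Fin m → HalfInt k := f ∘ Equiv.swap a b

/-- `f` with the entry at the place `a` negated. -/
def negAt (a : Fin m) (f : Fin m → HalfInt k) : Fin m → HalfInt k :=
  Function.update f a (f a).neg

/-- The operator of `H_i` (`i > 0`), which acts at the places `a`, `b` (to be `i`, `i + 1`). -/
def swapOp (a b : Fin m) : Module.End K (Tens K k m) :=
  (tensBasis K k m).constr K fun f =>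
    if f a = f b then (q : K)⁻¹ • tensBasis K k m f
    else if f a < f b then tensBasis K k m (swapAt a b f)
    else tensBasis K k m (swapAt a b f) + ((q : K)⁻¹ - (q : K)) • tensBasis K k m f

/-- The operator of `H_0`, which acts at the place `a` (to be the first one). -/
def negOp (a : Fin m) : Module.End K (Tens K k m) :=
  (tensBasis K k m).constr K fun f =>
    if 0 < (f a).1 then tensBasis K k m (negAt a f)
    else tensBasis K k m (negAt a f) + ((q : K)⁻¹ - (q : K)) • tensBasis K k m f

/-- The operator of right multiplication by `H_i` on the tensor power. As `Fin m` is numbered from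
`0`, the places `i` and `i + 1` of the usual numbering are `i - 1` and `i` here. -/
def heckeOp (i : Fin m) : Module.End K (Tens K k m) :=
  if (i : ℕ) = 0 then negOp q i else swapOp q ⟨i - 1, by omega⟩ i

theorem swapOp_lt {a b : Fin m} {f : Fin m → HalfInt k} (h : (f a).1 < (f b).1) :
    swapOp q a b (tensBasis K k m f) = tensBasis K k m (swapAt a b f) := by
  have h1 : f a ≠ f b := fun e => by rw [e] at h; exact lt_irrefl _ h
  have h2 : f a < f b := h
  rw [swapOp, Module.Basis.constr_basis, if_neg h1, if_pos h2]

theorem swapOp_gt {a b : Fin m} {f : Fin m → HalfInt k} (h : (f b).1 < (f a).1) :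
    swapOp q a b (tensBasis K k m f) =
      tensBasis K k m (swapAt a b f) + ((q : K)⁻¹ - (q : K)) • tensBasis K k m f := by
  have h1 : f a ≠ f b := fun e => by rw [e] at h; exact lt_irrefl _ h
  have h2 : ¬ f a < f b := not_lt.2 (le_of_lt (show f b < f a from h))
  rw [swapOp, Module.Basis.constr_basis, if_neg h1, if_neg h2]

theorem swapOp_eq {a b : Fin m} {f : Fin m → HalfInt k} (h : (f a).1 = (f b).1) :
    swapOp q a b (tensBasis K k m f) = (q : K)⁻¹ • tensBasis K k m f := by
  rw [swapOp, Module.Basis.constr_basis, if_pos (Subtype.ext h)]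

theorem negOp_pos {a : Fin m} {f : Fin m → HalfInt k} (h : 0 < (f a).1) :
    negOp q a (tensBasis K k m f) = tensBasis K k m (negAt a f) := by
  rw [negOp, Module.Basis.constr_basis, if_pos h]

theorem negOp_neg {a : Fin m} {f : Fin m → HalfInt k} (h : (f a).1 < 0) :
    negOp q a (tensBasis K k m f) =
      tensBasis K k m (negAt a f) + ((q : K)⁻¹ - (q : K)) • tensBasis K k m f := by
  rw [negOp, Module.Basis.constr_basis, if_neg (by omega)]

theorem swapAt_left (a b : Fin m) (f : Fin m → HalfInt k) : swapAt a b f a = f b := by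
  simp [swapAt]

theorem swapAt_right (a b : Fin m) (f : Fin m → HalfInt k) : swapAt a b f b = f a := by
  simp [swapAt]

theorem swapAt_of_ne {a b c : Fin m} (f : Fin m → HalfInt k) (h1 : c ≠ a) (h2 : c ≠ b) :
    swapAt a b f c = f c := by
  simp [swapAt, Equiv.swap_apply_of_ne_of_ne h1 h2]

theorem swapAt_swapAt (a b : Fin m) (f : Fin m → HalfInt k) : swapAt a b (swapAt a b f) = f := by
  funext c; simp [swapAt]

theorem negAt_same (a : Fin m) (f : Fin m → HalfInt k) : ((negAt a f) a).1 = -(f a).1 := by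
  simp [negAt, HalfInt.neg]

theorem negAt_of_ne {a c : Fin m} (f : Fin m → HalfInt k) (h : c ≠ a) : negAt a f c = f c := by
  simp [negAt, h]

theorem negAt_negAt (a : Fin m) (f : Fin m → HalfInt k) : negAt a (negAt a f) = f := by
  funext c
  by_cases h : c = a
  · subst h; apply Subtype.ext; rw [negAt_same, negAt_same, neg_neg]
  · rw [negAt_of_ne _ h, negAt_of_ne _ h]

theorem val_ne_zero (a : HalfInt k) : a.1 ≠ 0 := fun h => by
  have := a.2.1
  rw [h] at this
  exact absurd this (by decide)

theorem swapOp_quadratic (a b : Fin m) :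
    swapOp (k := k) q a b * swapOp q a b = 1 + ((q : K)⁻¹ - (q : K)) • swapOp q a b := by
  have hq := q.ne_zero
  refine (tensBasis K k m).ext fun f => ?_
  simp only [Module.End.mul_apply, LinearMap.add_apply, LinearMap.smul_apply, Module.End.one_apply]
  rcases lt_trichotomy (f a).1 (f b).1 with h | h | h
  · rw [swapOp_lt q h, swapOp_gt q (by rw [swapAt_left, swapAt_right]; exact h), swapAt_swapAt]
  · rw [swapOp_eq q h, map_smul, swapOp_eq q h]
    match_scalars
    field_simp
    ring
  · rw [swapOp_gt q h, map_add, map_smul, swapOp_gt q h,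
      swapOp_lt q (by rw [swapAt_left, swapAt_right]; exact h), swapAt_swapAt]

theorem negOp_quadratic (a : Fin m) :
    negOp (k := k) q a * negOp q a = 1 + ((q : K)⁻¹ - (q : K)) • negOp q a := by
  refine (tensBasis K k m).ext fun f => ?_
  simp only [Module.End.mul_apply, LinearMap.add_apply, LinearMap.smul_apply, Module.End.one_apply]
  have h0 := val_ne_zero (f a)
  rcases lt_or_gt_of_ne h0 with h | h
  · rw [negOp_neg q h, map_add, map_smul, negOp_neg q h,
      negOp_pos q (by rw [negAt_same]; omega), negAt_negAt]
  · rw [negOp_pos q h, negOp_neg q (by rw [negAt_same]; omega), negAt_negAt]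

theorem swapAt_braid {a b c : Fin m} (hab : a ≠ b) (hac : a ≠ c) (hbc : b ≠ c)
    (f : Fin m → HalfInt k) :
    swapAt a b (swapAt b c (swapAt a b f)) = swapAt b c (swapAt a b (swapAt b c f)) := by
  have h := swap_braid hab hac hbc
  funext x
  have hx := congrArg (fun σ : Equiv.Perm (Fin m) => f (σ x)) h
  exact hx

theorem swapOp_braid {a b c : Fin m} (hab : a ≠ b) (hac : a ≠ c) (hbc : b ≠ c) :
    swapOp (k := k) q a b * swapOp q b c * swapOp q a b =
      swapOp q b c * swapOp q a b * swapOp q b c := by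
  have hq := q.ne_zero
  refine (tensBasis K k m).ext fun f => ?_
  simp only [Module.End.mul_apply]
  have e1 : ∀ g : Fin m → HalfInt k, swapAt a b g c = g c :=
    fun g => swapAt_of_ne g hac.symm hbc.symm
  have e2 : ∀ g : Fin m → HalfInt k, swapAt b c g a = g a :=
    fun g => swapAt_of_ne g hab hac
  have e3 := swapAt_braid (k := k) hab hac hbc f
  rcases lt_trichotomy (f a).1 (f b).1 with h1 | h1 | h1 <;>
  rcases lt_trichotomy (f b).1 (f c).1 with h2 | h2 | h2 <;>
  rcases lt_trichotomy (f a).1 (f c).1 with h3 | h3 | h3 <;>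
  first
  | (exfalso; omega)
  | (simp (disch := first | omega | (simp only [e1, e2, swapAt_left, swapAt_right]; omega)) only
      [swapOp_lt, swapOp_gt, swapOp_eq, map_add, map_smul, swapAt_swapAt, e3]
     try (match_scalars <;> field_simp <;> ring))

theorem swapOp_comm {a b c d : Fin m} (hac : a ≠ c) (had : a ≠ d) (hbc : b ≠ c) (hbd : b ≠ d) :
    swapOp (k := k) q a b * swapOp q c d = swapOp q c d * swapOp q a b := by
  refine (tensBasis K k m).ext fun f => ?_
  simp only [Module.End.mul_apply]
  have e1 : ∀ g : Fin m → HalfInt k, swapAt a b g c = g c :=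
    fun g => swapAt_of_ne g hac.symm hbc.symm
  have e2 : ∀ g : Fin m → HalfInt k, swapAt a b g d = g d :=
    fun g => swapAt_of_ne g had.symm hbd.symm
  have e3 : ∀ g : Fin m → HalfInt k, swapAt c d g a = g a := fun g => swapAt_of_ne g hac had
  have e4 : ∀ g : Fin m → HalfInt k, swapAt c d g b = g b := fun g => swapAt_of_ne g hbc hbd
  have e5 : swapAt a b (swapAt c d f) = swapAt c d (swapAt a b f) := by
    have h : Equiv.swap c d * Equiv.swap a b = Equiv.swap a b * Equiv.swap c d :=
      (Equiv.Perm.disjoint_iff_disjoint_support.2 (by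
        by_cases h1 : c = d
        · subst h1; simp
        by_cases h2 : a = b
        · subst h2; simp
        rw [Equiv.Perm.support_swap h1, Equiv.Perm.support_swap h2]
        simp [hac, had, hbc, hbd])).commute
    funext x
    have hx := congrArg (fun σ : Equiv.Perm (Fin m) => f (σ x)) h
    exact hx
  rcases lt_trichotomy (f a).1 (f b).1 with h1 | h1 | h1 <;>
  rcases lt_trichotomy (f c).1 (f d).1 with h2 | h2 | h2 <;>
    (simp (disch := first | omega | (simp only [e1, e2, e3, e4, swapAt_left, swapAt_right]; omega)) only
      [swapOp_lt, swapOp_gt, swapOp_eq, map_add, map_smul, e5]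
     try module)

theorem negOp_swapOp_comm {a c d : Fin m} (hac : a ≠ c) (had : a ≠ d) :
    negOp (k := k) q a * swapOp q c d = swapOp q c d * negOp q a := by
  refine (tensBasis K k m).ext fun f => ?_
  simp only [Module.End.mul_apply]
  have e1 : ∀ g : Fin m → HalfInt k, negAt a g c = g c := fun g => negAt_of_ne g hac.symm
  have e2 : ∀ g : Fin m → HalfInt k, negAt a g d = g d := fun g => negAt_of_ne g had.symm
  have e3 : ∀ g : Fin m → HalfInt k, swapAt c d g a = g a := fun g => swapAt_of_ne g hac had
  have e5 : negAt a (swapAt c d f) = swapAt c d (negAt a f) := by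
    funext x
    apply Subtype.ext
    by_cases h1 : x = a
    · subst h1; rw [negAt_same, e3, e3, negAt_same]
    rw [negAt_of_ne _ h1]
    by_cases h2 : x = c
    · subst h2; rw [swapAt_left, swapAt_left, e2]
    by_cases h3 : x = d
    · subst h3; rw [swapAt_right, swapAt_right, e1]
    rw [swapAt_of_ne _ h2 h3, swapAt_of_ne _ h2 h3, negAt_of_ne _ h1]
  rcases lt_or_gt_of_ne (val_ne_zero (f a)) with h1 | h1 <;>
  rcases lt_trichotomy (f c).1 (f d).1 with h2 | h2 | h2 <;>
    (simp (disch := first | omega | (simp only [e1, e2, e3, swapAt_left, swapAt_right]; omega)) only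
      [swapOp_lt, swapOp_gt, swapOp_eq, negOp_pos, negOp_neg, map_add, map_smul, e5]
     try module)

theorem negOp_swapOp_braid {a b : Fin m} (hab : a ≠ b) :
    negOp (k := k) q a * swapOp q a b * negOp q a * swapOp q a b =
      swapOp q a b * negOp q a * swapOp q a b * negOp q a := by
  have hq := q.ne_zero
  refine (tensBasis K k m).ext fun f => ?_
  simp only [Module.End.mul_apply]
  have e1 : ∀ g : Fin m → HalfInt k, negAt a g b = g b := fun g => negAt_of_ne g hab.symm
  have e5 : negAt a (swapAt a b (negAt a (swapAt a b f))) =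
      swapAt a b (negAt a (swapAt a b (negAt a f))) := by
    funext x
    apply Subtype.ext
    by_cases h1 : x = a
    · subst h1; simp only [negAt_same, e1, swapAt_left, swapAt_right]
    by_cases h2 : x = b
    · subst h2; simp only [negAt_same, e1, swapAt_left, swapAt_right]
    simp only [negAt_of_ne _ h1, swapAt_of_ne _ h1 h2]
  rcases lt_or_gt_of_ne (val_ne_zero (f a)) with h1 | h1 <;>
  rcases lt_or_gt_of_ne (val_ne_zero (f b)) with h4 | h4 <;>
  rcases lt_trichotomy (f a).1 (f b).1 with h2 | h2 | h2 <;>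
  rcases lt_trichotomy (f a).1 (-(f b).1) with h3 | h3 | h3 <;>
  first
  | (exfalso; omega)
  | (simp (disch := first | omega | (simp only [e1, negAt_same, swapAt_left, swapAt_right]; omega)) only
      [swapOp_lt, swapOp_gt, swapOp_eq, negOp_pos, negOp_neg, map_add, map_smul, e5,
        swapAt_swapAt, negAt_negAt]
     try (match_scalars <;> field_simp <;> ring))

theorem heckeOp_zero {i : Fin m} (h : (i : ℕ) = 0) : heckeOp (k := k) q i = negOp q i := if_pos h

theorem heckeOp_pos {i : Fin m} (h : 0 < (i : ℕ)) :
    heckeOp (k := k) q i = swapOp q ⟨i - 1, by omega⟩ i := if_neg h.ne'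

theorem heckeOp_mul_self (i : Fin m) :
    heckeOp (k := k) q i * heckeOp q i = 1 + ((q : K)⁻¹ - (q : K)) • heckeOp q i := by
  rcases Nat.eq_zero_or_pos i with h | h
  · rw [heckeOp_zero q h, negOp_quadratic]
  · rw [heckeOp_pos q h, swapOp_quadratic]

theorem heckeOp_quadratic (i : Fin m) :
    (heckeOp (k := k) q i + algebraMap K (Module.End K (Tens K k m)) (-(q : K)⁻¹)) *
      (heckeOp q i + algebraMap K (Module.End K (Tens K k m)) (q : K)) = 0 := by
  have h := q.ne_zero
  apply LinearMap.ext
  intro v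
  have h2 := LinearMap.congr_fun (heckeOp_mul_self (k := k) q i) v
  simp only [Module.End.mul_apply, LinearMap.add_apply, Module.End.one_apply,
    LinearMap.smul_apply, Module.algebraMap_end_apply, map_add, map_smul,
    LinearMap.zero_apply] at h2 ⊢
  rw [h2]
  match_scalars
  · field_simp
    ring
  · ring

theorem heckeOp_quadratic' (i : Fin m) :
    (heckeOp (k := k) q i + algebraMap K (Module.End K (Tens K k m)) (q : K)) *
      (heckeOp q i + algebraMap K (Module.End K (Tens K k m)) (-(q : K)⁻¹)) = 0 := by
  have h := q.ne_zero
  apply LinearMap.ext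
  intro v
  have h2 := LinearMap.congr_fun (heckeOp_mul_self (k := k) q i) v
  simp only [Module.End.mul_apply, LinearMap.add_apply, Module.End.one_apply,
    LinearMap.smul_apply, Module.algebraMap_end_apply, map_add, map_smul,
    LinearMap.zero_apply] at h2 ⊢
  rw [h2]
  match_scalars
  · field_simp
    ring
  · ring

theorem heckeOp_braid (i j : Fin m) (hi : 0 < (i : ℕ)) (hij : (j : ℕ) = i + 1) :
    heckeOp (k := k) q i * heckeOp q j * heckeOp q i =
      heckeOp q j * heckeOp q i * heckeOp q j := by
  have e : (⟨j - 1, by omega⟩ : Fin m) = i := Fin.ext (by simp [hij])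
  rw [heckeOp_pos q hi, heckeOp_pos q (show 0 < (j : ℕ) by omega), e]
  exact swapOp_braid q (by simp only [ne_eq, Fin.ext_iff]; omega)
    (by simp only [ne_eq, Fin.ext_iff]; omega) (by simp only [ne_eq, Fin.ext_iff]; omega)

theorem heckeOp_comm (i j : Fin m) (hij : (i : ℕ) + 1 < j) :
    heckeOp (k := k) q i * heckeOp q j = heckeOp q j * heckeOp q i := by
  rw [heckeOp_pos q (show 0 < (j : ℕ) by omega)]
  rcases Nat.eq_zero_or_pos i with h | h
  · rw [heckeOp_zero q h]
    exact negOp_swapOp_comm q (by simp only [ne_eq, Fin.ext_iff]; omega)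
      (by simp only [ne_eq, Fin.ext_iff]; omega)
  · rw [heckeOp_pos q h]
    exact swapOp_comm q (by simp only [ne_eq, Fin.ext_iff]; omega)
      (by simp only [ne_eq, Fin.ext_iff]; omega) (by simp only [ne_eq, Fin.ext_iff]; omega)
      (by simp only [ne_eq, Fin.ext_iff]; omega)

theorem heckeOp_braidB (i j : Fin m) (hi : (i : ℕ) = 0) (hj : (j : ℕ) = 1) :
    heckeOp (k := k) q i * heckeOp q j * heckeOp q i * heckeOp q j =
      heckeOp q j * heckeOp q i * heckeOp q j * heckeOp q i := by
  have e : (⟨j - 1, by omega⟩ : Fin m) = i := Fin.ext (by simp [hi, hj])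
  rw [heckeOp_zero q hi, heckeOp_pos q (show 0 < (j : ℕ) by omega), e]
  exact negOp_swapOp_braid q (by simp only [ne_eq, Fin.ext_iff]; omega)

/-- The representation `Ψ` of `𝓗(B_m)` on the tensor power by right multiplication: an algebra
homomorphism to the opposite algebra, that is, an anti-homomorphism to the endomorphisms. For
`k = r + 1` it is the representation `Ψ^V_m` on the tensor power of `V`. -/
def Psi (k m : ℕ) : HeckeB q m →ₐ[K] (Module.End K (Tens K k m))ᵐᵒᵖ :=
  RingQuot.liftAlgHom K ⟨FreeAlgebra.lift K fun i => op (heckeOp q i), by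
    intro x y h
    induction h with
    | quadratic i =>
      rw [sub_eq_add_neg, ← map_neg]
      simp only [map_mul, map_add, map_zero, AlgHom.commutes, FreeAlgebra.lift_ι_apply,
        MulOpposite.algebraMap_apply, ← op_add, ← op_mul]
      rw [heckeOp_quadratic' q i, op_zero]
    | braid i j hi hij =>
      simp only [map_mul, FreeAlgebra.lift_ι_apply, ← op_mul, ← mul_assoc]
      rw [heckeOp_braid q i j hi hij]
    | comm i j hij =>
      simp only [map_mul, FreeAlgebra.lift_ι_apply, ← op_mul]
      rw [heckeOp_comm q i j hij]
    | braidB i j hi hj =>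
      simp only [map_mul, FreeAlgebra.lift_ι_apply, ← op_mul, ← mul_assoc]
      rw [heckeOp_braidB q i j hi hj]⟩

theorem Psi_H (i : Fin m) : Psi q k m (HeckeB.H q i) = op (heckeOp q i) := by
  unfold Psi HeckeB.H HeckeB.mk
  exact (RingQuot.liftAlgHom_mkAlgHom_apply K _ _ _).trans (FreeAlgebra.lift_ι_apply _ _)

end Operators

/-! ### The duplex Hecke algebra -/

/-- The generators `T_i` (`0 ≤ i ≤ m - 1`) and `x_σ^{(l)}` (`0 ≤ l ≤ m`, `σ ∈ 𝔖_l`). -/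
inductive DuplexGen (m : ℕ) : Type
  | T (i : Fin m) : DuplexGen m
  | x (l : Fin (m + 1)) (σ : Equiv.Perm (Fin l)) : DuplexGen m

/-- The letter `T_i` of the free algebra. -/
def freeT (K : Type*) [Field K] {m : ℕ} (i : Fin m) : FreeAlgebra K (DuplexGen m) :=
  FreeAlgebra.ι K (DuplexGen.T i)

/-- The letter `x_σ^{(l)}` of the free algebra. -/
def freeX (K : Type*) [Field K] {m : ℕ} (l : Fin (m + 1)) (σ : Equiv.Perm (Fin l)) :
    FreeAlgebra K (DuplexGen m) :=
  FreeAlgebra.ι K (DuplexGen.x l σ)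

/-- The defining relations of the duplex Hecke algebra of type B. An index `j : Fin (l - 1)` stands
for the index `j + 1` with `0 < j + 1 < l`, and `simpleRefl l j` for `s_{j+1}`. -/
inductive DuplexRel {K : Type*} [Field K] (q : Kˣ) (m : ℕ) :
    FreeAlgebra K (DuplexGen m) → FreeAlgebra K (DuplexGen m) → Prop
  | quadratic (i : Fin m) : DuplexRel q m
      ((freeT K i + algebraMap K _ (q : K)) * (freeT K i - algebraMap K _ (q : K)⁻¹)) 0
  | braid (i j : Fin m) (hi : 0 < (i : ℕ)) (hij : (j : ℕ) = i + 1) : DuplexRel q m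
      (freeT K i * freeT K j * freeT K i) (freeT K j * freeT K i * freeT K j)
  | comm (i j : Fin m) (hij : (i : ℕ) + 1 < j) : DuplexRel q m
      (freeT K i * freeT K j) (freeT K j * freeT K i)
  | braidB (i j : Fin m) (hi : (i : ℕ) = 0) (hj : (j : ℕ) = 1) : DuplexRel q m
      (freeT K i * freeT K j * freeT K i * freeT K j)
      (freeT K j * freeT K i * freeT K j * freeT K i)
  | x_mul_up (l : Fin (m + 1)) (σ : Equiv.Perm (Fin l)) (j : Fin ((l : ℕ) - 1))
      (h : len (σ * simpleRefl l j) = len σ + 1) : DuplexRel q m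
      (freeX K l σ * freeX K l (simpleRefl l j)) (freeX K l (σ * simpleRefl l j))
  | x_mul_down (l : Fin (m + 1)) (σ : Equiv.Perm (Fin l)) (j : Fin ((l : ℕ) - 1))
      (h : len (σ * simpleRefl l j) + 1 = len σ) : DuplexRel q m
      (freeX K l σ * freeX K l (simpleRefl l j))
      (freeX K l (σ * simpleRefl l j) + ((q : K)⁻¹ - (q : K)) • freeX K l σ)
  | mul_x_up (l : Fin (m + 1)) (σ : Equiv.Perm (Fin l)) (j : Fin ((l : ℕ) - 1))
      (h : len (simpleRefl l j * σ) = len σ + 1) : DuplexRel q m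
      (freeX K l (simpleRefl l j) * freeX K l σ) (freeX K l (simpleRefl l j * σ))
  | mul_x_down (l : Fin (m + 1)) (σ : Equiv.Perm (Fin l)) (j : Fin ((l : ℕ) - 1))
      (h : len (simpleRefl l j * σ) + 1 = len σ) : DuplexRel q m
      (freeX K l (simpleRefl l j) * freeX K l σ)
      (freeX K l (simpleRefl l j * σ) + ((q : K)⁻¹ - (q : K)) • freeX K l σ)
  | x_orthogonal (l k : Fin (m + 1)) (hlk : l ≠ k) (σ : Equiv.Perm (Fin l))
      (γ : Equiv.Perm (Fin k)) : DuplexRel q m (freeX K l σ * freeX K k γ) 0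
  | T_mul_x_lt (l : Fin (m + 1)) (σ : Equiv.Perm (Fin l)) (i : Fin m) (j : Fin ((l : ℕ) - 1))
      (hij : (i : ℕ) = j + 1) : DuplexRel q m
      (freeT K i * freeX K l σ) (freeX K l (simpleRefl l j) * freeX K l σ)
  | x_mul_T_lt (l : Fin (m + 1)) (σ : Equiv.Perm (Fin l)) (i : Fin m) (j : Fin ((l : ℕ) - 1))
      (hij : (i : ℕ) = j + 1) : DuplexRel q m
      (freeX K l σ * freeT K i) (freeX K l σ * freeX K l (simpleRefl l j))
  | T_mul_x_gt (l : Fin (m + 1)) (σ : Equiv.Perm (Fin l)) (i : Fin m) (hil : (l : ℕ) < i) :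
      DuplexRel q m (freeT K i * freeX K l σ) ((q : K)⁻¹ • freeX K l σ)
  | x_mul_T_gt (l : Fin (m + 1)) (σ : Equiv.Perm (Fin l)) (i : Fin m) (hil : (l : ℕ) < i) :
      DuplexRel q m (freeX K l σ * freeT K i) ((q : K)⁻¹ • freeX K l σ)

/-- The duplex Hecke algebra of type B. -/
def Duplex {K : Type*} [Field K] (q : Kˣ) (m : ℕ) : Type _ := RingQuot (DuplexRel q m)

instance {K : Type*} [Field K] (q : Kˣ) (m : ℕ) : Ring (Duplex q m) :=
  inferInstanceAs (Ring (RingQuot (DuplexRel q m)))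

instance {K : Type*} [Field K] (q : Kˣ) (m : ℕ) : Algebra K (Duplex q m) :=
  inferInstanceAs (Algebra K (RingQuot (DuplexRel q m)))

/-- The quotient map from the free algebra. -/
def Duplex.mk {K : Type*} [Field K] (q : Kˣ) (m : ℕ) :
    FreeAlgebra K (DuplexGen m) →ₐ[K] Duplex q m :=
  RingQuot.mkAlgHom K (DuplexRel q m)

/-- The generator `T_i` of the duplex Hecke algebra. -/
def Duplex.T {K : Type*} [Field K] (q : Kˣ) {m : ℕ} (i : Fin m) : Duplex q m :=
  Duplex.mk q m (freeT K i)

/-- The generator `x_σ^{(l)}` of the duplex Hecke algebra. -/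
def Duplex.x {K : Type*} [Field K] (q : Kˣ) {m : ℕ} (l : Fin (m + 1)) (σ : Equiv.Perm (Fin l)) :
    Duplex q m :=
  Duplex.mk q m (freeX K l σ)

/-! ### The action of the duplex Hecke algebra on tensor space -/

/-- The inclusion of the indices of `V` in those of `V̲`. -/
def HalfInt.incl {r : ℕ} (a : HalfInt (r + 1)) : HalfInt (r + 2) :=
  ⟨a.1, a.2.1, by have := a.2.2; push_cast at this ⊢; omega⟩

/-- The largest index `r + 3/2` of `V̲`. -/
def topIndex (r : ℕ) : HalfInt (r + 2) :=
  ⟨2 * r + 3, ⟨r + 1, by ring⟩, by rw [abs_of_nonneg (by positivity)]; push_cast; omega⟩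

/-- `(g(1), …, g(l), r + 3/2, …, r + 3/2)`. -/
def extendTop {r : ℕ} (m : ℕ) {l : ℕ} (g : Fin l → HalfInt (r + 1)) : Fin m → HalfInt (r + 2) :=
  fun i => if h : (i : ℕ) < l then (g ⟨i, h⟩).incl else topIndex r

section Action

variable {K : Type*} [Field K] (q : Kˣ) {r m : ℕ}

/-- The linear map `V^{⊗l} → V̲^{⊗m}`, `v ↦ v ⊗ η_{r+3/2}^{⊗(m-l)}`. -/
def embTop (K : Type*) [Field K] (r m l : ℕ) : Tens K (r + 1) l →ₗ[K] Tens K (r + 2) m :=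
  (tensBasis K (r + 1) l).constr K fun g => tensBasis K (r + 2) m (extendTop m g)

open Classical in
/-- The linear map `V̲^{⊗m} → V^{⊗l}` that takes `v ⊗ η_{r+3/2}^{⊗(m-l)}` to `v` and all basis
vectors `M_f` not of the form `M_g ⊗ η_{r+3/2}^{⊗(m-l)}` with `M_g ∈ V^{⊗l}` to zero. -/
def projTop (K : Type*) [Field K] (r m l : ℕ) : Tens K (r + 2) m →ₗ[K] Tens K (r + 1) l :=
  (tensBasis K (r + 2) m).constr K fun f =>
    if h : ∃ g : Fin l → HalfInt (r + 1), extendTop m g = f then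
      tensBasis K (r + 1) l h.choose
    else 0

theorem incl_val {r : ℕ} (a : HalfInt (r + 1)) : a.incl.1 = a.1 := rfl

theorem incl_lt_top {r : ℕ} (a : HalfInt (r + 1)) : a.1 < 2 * r + 3 := by
  have := a.2.2
  rw [abs_lt] at this
  push_cast at this
  omega

theorem extendTop_of_lt {l : ℕ} (g : Fin l → HalfInt (r + 1)) (i : Fin m) (h : (i : ℕ) < l) :
    extendTop m g i = (g ⟨i, h⟩).incl := dif_pos h

theorem extendTop_of_ge {l : ℕ} (g : Fin l → HalfInt (r + 1)) (i : Fin m) (h : l ≤ (i : ℕ)) :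
    extendTop m g i = topIndex r := dif_neg (not_lt.2 h)

theorem extendTop_injective {l : ℕ} (hl : l ≤ m) :
    Function.Injective (extendTop (r := r) (l := l) m) := by
  intro g g' h
  funext i
  have hi := congrFun h ⟨i, by omega⟩
  rw [extendTop_of_lt (m := m) g ⟨i, by omega⟩ i.2,
    extendTop_of_lt (m := m) g' ⟨i, by omega⟩ i.2] at hi
  have h3 := congrArg Subtype.val hi
  exact Subtype.ext h3

theorem extendTop_ne {l l' : ℕ} (hl : l ≤ m) (hl' : l' ≤ m) (h : l ≠ l')
    (g : Fin l → HalfInt (r + 1)) (g' : Fin l' → HalfInt (r + 1)) :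
    extendTop m g ≠ extendTop m g' := by
  intro he
  rcases lt_or_gt_of_ne h with h | h
  · have hi := congrArg Subtype.val (congrFun he ⟨l, by omega⟩)
    rw [extendTop_of_ge g ⟨l, by omega⟩ le_rfl, extendTop_of_lt g' ⟨l, by omega⟩ h, incl_val] at hi
    exact absurd hi (incl_lt_top _).ne'
  · have hi := congrArg Subtype.val (congrFun he ⟨l', by omega⟩)
    rw [extendTop_of_ge g' ⟨l', by omega⟩ le_rfl, extendTop_of_lt g ⟨l', by omega⟩ h, incl_val] at hi
    exact absurd hi (incl_lt_top _).ne

theorem embTop_basis {l : ℕ} (g : Fin l → HalfInt (r + 1)) :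
    embTop K r m l (tensBasis K (r + 1) l g) = tensBasis K (r + 2) m (extendTop m g) :=
  Module.Basis.constr_basis _ _ _ _

theorem projTop_extend {l : ℕ} (hl : l ≤ m) (g : Fin l → HalfInt (r + 1)) :
    projTop K r m l (tensBasis K (r + 2) m (extendTop m g)) = tensBasis K (r + 1) l g := by
  have h : ∃ g' : Fin l → HalfInt (r + 1), extendTop m g' = extendTop m g := ⟨g, rfl⟩
  rw [projTop, Module.Basis.constr_basis, dif_pos h, extendTop_injective hl h.choose_spec]

theorem projTop_of_not {l : ℕ} {f : Fin m → HalfInt (r + 2)}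
    (h : ¬ ∃ g : Fin l → HalfInt (r + 1), extendTop m g = f) :
    projTop K r m l (tensBasis K (r + 2) m f) = 0 := by
  rw [projTop, Module.Basis.constr_basis, dif_neg h]

theorem projTop_comp_embTop {l : ℕ} (hl : l ≤ m) :
    projTop K r m l ∘ₗ embTop K r m l = LinearMap.id := by
  refine (tensBasis K (r + 1) l).ext fun g => ?_
  rw [LinearMap.comp_apply, embTop_basis, projTop_extend hl, LinearMap.id_apply]

theorem projTop_comp_embTop_ne {l l' : ℕ} (hl : l ≤ m) (hl' : l' ≤ m) (h : l ≠ l') :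
    projTop K r m l ∘ₗ embTop K r m l' = 0 := by
  refine (tensBasis K (r + 1) l').ext fun g => ?_
  rw [LinearMap.comp_apply, embTop_basis, projTop_of_not, LinearMap.zero_apply]
  rintro ⟨g', hg'⟩
  exact extendTop_ne hl hl' h g' g hg'

theorem swapAt_extendTop_lt {l : ℕ} (g : Fin l → HalfInt (r + 1)) (a b : Fin m) (ha : (a : ℕ) < l)
    (hb : (b : ℕ) < l) : swapAt a b (extendTop m g) = extendTop m (swapAt ⟨a, ha⟩ ⟨b, hb⟩ g) := by
  funext c
  by_cases hca : c = a
  · subst hca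
    rw [swapAt_left, extendTop_of_lt g _ hb, extendTop_of_lt _ _ ha, swapAt_left]
  by_cases hcb : c = b
  · subst hcb
    rw [swapAt_right, extendTop_of_lt g _ ha, extendTop_of_lt _ _ hb, swapAt_right]
  rw [swapAt_of_ne _ hca hcb]
  by_cases hc : (c : ℕ) < l
  · rw [extendTop_of_lt g _ hc, extendTop_of_lt _ _ hc, swapAt_of_ne]
    · simpa [Fin.ext_iff] using hca
    · simpa [Fin.ext_iff] using hcb
  · rw [extendTop_of_ge g _ (not_lt.1 hc), extendTop_of_ge _ _ (not_lt.1 hc)]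

theorem swapAt_extendTop_ge {l : ℕ} (g : Fin l → HalfInt (r + 1)) (a b : Fin m) (ha : l ≤ (a : ℕ))
    (hb : l ≤ (b : ℕ)) : swapAt a b (extendTop m g) = extendTop m g := by
  funext c
  by_cases hca : c = a
  · subst hca
    rw [swapAt_left, extendTop_of_ge g _ hb, extendTop_of_ge _ _ ha]
  by_cases hcb : c = b
  · subst hcb
    rw [swapAt_right, extendTop_of_ge g _ ha, extendTop_of_ge _ _ hb]
  rw [swapAt_of_ne _ hca hcb]

theorem swapOp_extendTop_lt {l : ℕ} (g : Fin l → HalfInt (r + 1)) (a b : Fin m) (ha : (a : ℕ) < l)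
    (hb : (b : ℕ) < l) :
    swapOp q a b (tensBasis K (r + 2) m (extendTop m g)) =
      embTop K r m l (swapOp q ⟨a, ha⟩ ⟨b, hb⟩ (tensBasis K (r + 1) l g)) := by
  have e1 : (extendTop m g a).1 = (g ⟨a, ha⟩).1 := by rw [extendTop_of_lt g _ ha, incl_val]
  have e2 : (extendTop m g b).1 = (g ⟨b, hb⟩).1 := by rw [extendTop_of_lt g _ hb, incl_val]
  rcases lt_trichotomy (g ⟨a, ha⟩).1 (g ⟨b, hb⟩).1 with h | h | h
  · rw [swapOp_lt q (by rwa [e1, e2]), swapOp_lt q h, embTop_basis,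
      swapAt_extendTop_lt g a b ha hb]
  · rw [swapOp_eq q (by rwa [e1, e2]), swapOp_eq q h, map_smul, embTop_basis]
  · rw [swapOp_gt q (by rwa [e1, e2]), swapOp_gt q h, map_add, map_smul, embTop_basis,
      embTop_basis, swapAt_extendTop_lt g a b ha hb]

theorem swapOp_extendTop_ge {l : ℕ} (g : Fin l → HalfInt (r + 1)) (a b : Fin m) (ha : l ≤ (a : ℕ))
    (hb : l ≤ (b : ℕ)) :
    swapOp q a b (tensBasis K (r + 2) m (extendTop m g)) =
      (q : K)⁻¹ • tensBasis K (r + 2) m (extendTop m g) :=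
  swapOp_eq q (by rw [extendTop_of_ge g _ ha, extendTop_of_ge g _ hb])

theorem projTop_swapOp_of_not {l : ℕ} {f : Fin m → HalfInt (r + 2)} {a b : Fin m}
    (h : ¬ ∃ g : Fin l → HalfInt (r + 1), extendTop m g = f)
    (hab : ((a : ℕ) < l ∧ (b : ℕ) < l) ∨ (l ≤ (a : ℕ) ∧ l ≤ (b : ℕ))) :
    projTop K r m l (swapOp q a b (tensBasis K (r + 2) m f)) = 0 := by
  have h' : ¬ ∃ g : Fin l → HalfInt (r + 1), extendTop m g = swapAt a b f := by
    rintro ⟨g, hg⟩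
    apply h
    rcases hab with ⟨ha, hb⟩ | ⟨ha, hb⟩
    · exact ⟨_, by rw [← swapAt_extendTop_lt g a b ha hb, hg, swapAt_swapAt]⟩
    · exact ⟨g, by rw [← swapAt_extendTop_ge g a b ha hb, hg, swapAt_swapAt]⟩
  rcases lt_trichotomy (f a).1 (f b).1 with h1 | h1 | h1
  · rw [swapOp_lt q h1, projTop_of_not h']
  · rw [swapOp_eq q h1, map_smul, projTop_of_not h, smul_zero]
  · rw [swapOp_gt q h1, map_add, map_smul, projTop_of_not h', projTop_of_not h, smul_zero,
      add_zero]

theorem heckeOp_comp_embTop_lt {l : ℕ} (i : Fin m) (j : Fin l) (hi : 0 < (i : ℕ))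
    (hij : (i : ℕ) = j) :
    heckeOp q i ∘ₗ embTop K r m l = embTop K r m l ∘ₗ heckeOp q j := by
  refine (tensBasis K (r + 1) l).ext fun g => ?_
  rw [LinearMap.comp_apply, LinearMap.comp_apply, embTop_basis, heckeOp_pos q hi,
    swapOp_extendTop_lt q g _ _ (show (i : ℕ) - 1 < l by omega) (show (i : ℕ) < l by omega),
    heckeOp_pos q (show 0 < (j : ℕ) by omega)]
  have e1 : (⟨i, by omega⟩ : Fin l) = j := Fin.ext hij
  have e2 : (⟨i - 1, by omega⟩ : Fin l) = ⟨j - 1, by omega⟩ := Fin.ext (by simp [hij])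
  rw [e1, e2]

theorem projTop_comp_heckeOp_lt {l : ℕ} (hl : l ≤ m) (i : Fin m) (j : Fin l) (hi : 0 < (i : ℕ))
    (hij : (i : ℕ) = j) :
    projTop K r m l ∘ₗ heckeOp q i = heckeOp q j ∘ₗ projTop K r m l := by
  refine (tensBasis K (r + 2) m).ext fun f => ?_
  rw [LinearMap.comp_apply, LinearMap.comp_apply]
  by_cases h : ∃ g : Fin l → HalfInt (r + 1), extendTop m g = f
  · obtain ⟨g, rfl⟩ := h
    have h1 := LinearMap.congr_fun (heckeOp_comp_embTop_lt q (r := r) i j hi hij)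
      (tensBasis K (r + 1) l g)
    rw [LinearMap.comp_apply, LinearMap.comp_apply, embTop_basis] at h1
    rw [h1, projTop_extend hl, ← LinearMap.comp_apply, projTop_comp_embTop hl, LinearMap.id_apply]
  · rw [projTop_of_not h, map_zero, heckeOp_pos q hi, projTop_swapOp_of_not q h]
    exact Or.inl ⟨show (i : ℕ) - 1 < l by omega, by omega⟩

theorem heckeOp_comp_embTop_gt {l : ℕ} (i : Fin m) (hi : l < (i : ℕ)) :
    heckeOp q i ∘ₗ embTop K r m l = (q : K)⁻¹ • embTop K r m l := by
  refine (tensBasis K (r + 1) l).ext fun g => ?_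
  rw [LinearMap.comp_apply, LinearMap.smul_apply, embTop_basis,
    heckeOp_pos q (show 0 < (i : ℕ) by omega),
    swapOp_extendTop_ge q g _ _ (show l ≤ (i : ℕ) - 1 by omega) hi.le]

theorem projTop_comp_heckeOp_gt {l : ℕ} (i : Fin m) (hi : l < (i : ℕ)) :
    projTop K r m l ∘ₗ heckeOp q i = (q : K)⁻¹ • projTop K r m l := by
  refine (tensBasis K (r + 2) m).ext fun f => ?_
  rw [LinearMap.comp_apply, LinearMap.smul_apply, heckeOp_pos q (show 0 < (i : ℕ) by omega)]
  by_cases h : ∃ g : Fin l → HalfInt (r + 1), extendTop m g = f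
  · obtain ⟨g, rfl⟩ := h
    rw [swapOp_extendTop_ge q g _ _ (show l ≤ (i : ℕ) - 1 by omega) hi.le, map_smul]
  · rw [projTop_of_not h, smul_zero, projTop_swapOp_of_not q h]
    exact Or.inr ⟨show l ≤ (i : ℕ) - 1 by omega, hi.le⟩

/-- The operator of right multiplication by `h ∈ 𝓗(B_l)` on the first `l` factors of the summand
`V^{⊗l} ⊗ η_{r+3/2}^{⊗(m-l)}`, extended by zero to the other basis vectors `M_f`. -/
def topOp (r m : ℕ) {l : ℕ} (h : HeckeB q l) : Module.End K (Tens K (r + 2) m) :=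
  embTop K r m l ∘ₗ (Psi q (r + 1) l h).unop ∘ₗ projTop K r m l

/-- The operator of `x_σ^{(l)}`: it is `Ψ^V_l(H_σ) ⊗ id` on `V^{⊗l} ⊗ η_{r+3/2}^{⊗(m-l)}` and zero
on the other basis vectors. -/
def xOp (r m : ℕ) {l : ℕ} (σ : Equiv.Perm (Fin l)) : Module.End K (Tens K (r + 2) m) :=
  topOp q r m (HeckeB.perm q σ)

theorem topOp_mul {l : ℕ} (hl : l ≤ m) (h h' : HeckeB q l) :
    topOp q r m h' * topOp q r m h = topOp q r m (h * h') := by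
  unfold topOp
  rw [map_mul, unop_mul]
  apply LinearMap.ext
  intro v
  simp only [Module.End.mul_apply, LinearMap.comp_apply]
  rw [← LinearMap.comp_apply (projTop K r m l), projTop_comp_embTop hl, LinearMap.id_apply]

theorem topOp_add {l : ℕ} (h h' : HeckeB q l) :
    topOp q r m (h + h') = topOp q r m h + topOp q r m h' := by
  unfold topOp
  rw [map_add, unop_add, LinearMap.add_comp, LinearMap.comp_add]

theorem topOp_smul {l : ℕ} (c : K) (h : HeckeB q l) :
    topOp q r m (c • h) = c • topOp q r m h := by
  unfold topOp
  rw [map_smul, unop_smul, LinearMap.smul_comp, LinearMap.comp_smul]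

theorem topOp_mul_ne {l l' : ℕ} (hl : l ≤ m) (hl' : l' ≤ m) (hne : l ≠ l') (h : HeckeB q l)
    (h' : HeckeB q l') : topOp q r m h * topOp q r m h' = 0 := by
  unfold topOp
  apply LinearMap.ext
  intro v
  simp only [Module.End.mul_apply, LinearMap.comp_apply]
  rw [← LinearMap.comp_apply (projTop K r m l), projTop_comp_embTop_ne hl hl' hne]
  simp

theorem heckeOp_mul_topOp_lt {l : ℕ} (hl : l ≤ m) (i : Fin m) (j : Fin (l - 1))
    (hij : (i : ℕ) = j + 1) (h : HeckeB q l) :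
    heckeOp q i * topOp q r m h = topOp q r m (HeckeB.simpleH q j) * topOp q r m h := by
  rw [topOp_mul q hl]
  unfold topOp HeckeB.simpleH
  rw [map_mul, unop_mul, Psi_H, unop_op, Module.End.mul_eq_comp, ← LinearMap.comp_assoc,
    heckeOp_comp_embTop_lt q i ⟨j + 1, by omega⟩ (by omega) hij]
  rfl

theorem topOp_mul_heckeOp_lt {l : ℕ} (hl : l ≤ m) (i : Fin m) (j : Fin (l - 1))
    (hij : (i : ℕ) = j + 1) (h : HeckeB q l) :
    topOp q r m h * heckeOp q i = topOp q r m h * topOp q r m (HeckeB.simpleH q j) := by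
  rw [topOp_mul q hl]
  unfold topOp HeckeB.simpleH
  rw [map_mul, unop_mul, Psi_H, unop_op, Module.End.mul_eq_comp, LinearMap.comp_assoc,
    LinearMap.comp_assoc, projTop_comp_heckeOp_lt q hl i ⟨j + 1, by omega⟩ (by omega) hij]
  rfl

theorem heckeOp_mul_topOp_gt {l : ℕ} (i : Fin m) (hi : l < (i : ℕ)) (h : HeckeB q l) :
    heckeOp q i * topOp q r m h = (q : K)⁻¹ • topOp q r m h := by
  unfold topOp
  rw [Module.End.mul_eq_comp, ← LinearMap.comp_assoc, heckeOp_comp_embTop_gt q i hi,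
    LinearMap.smul_comp]

theorem topOp_mul_heckeOp_gt {l : ℕ} (i : Fin m) (hi : l < (i : ℕ)) (h : HeckeB q l) :
    topOp q r m h * heckeOp q i = (q : K)⁻¹ • topOp q r m h := by
  unfold topOp
  rw [Module.End.mul_eq_comp, LinearMap.comp_assoc, LinearMap.comp_assoc,
    projTop_comp_heckeOp_gt q i hi, LinearMap.comp_smul, LinearMap.comp_smul]

/-- The operators of the generators. -/
def genOp (r m : ℕ) : DuplexGen m → Module.End K (Tens K (r + 2) m)
  | DuplexGen.T i => heckeOp q i
  | DuplexGen.x _ σ => xOp q r m σ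

theorem lift_freeT (i : Fin m) :
    FreeAlgebra.lift K (fun g => op (genOp q r m g)) (freeT K i) = op (heckeOp q i) :=
  FreeAlgebra.lift_ι_apply _ _

theorem lift_freeX (l : Fin (m + 1)) (σ : Equiv.Perm (Fin l)) :
    FreeAlgebra.lift K (fun g => op (genOp q r m g)) (freeX K l σ) = op (xOp q r m σ) :=
  FreeAlgebra.lift_ι_apply _ _

/-- The representation `Ξ` of the duplex Hecke algebra on `V̲^{⊗m}`, an algebra homomorphism to the
opposite algebra of the endomorphisms (an anti-homomorphism to the endomorphisms). -/
def Xi (r m : ℕ) : Duplex q m →ₐ[K] (Module.End K (Tens K (r + 2) m))ᵐᵒᵖ :=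
  RingQuot.liftAlgHom K ⟨FreeAlgebra.lift K fun g => op (genOp q r m g), by
    intro x y h
    induction h with
    | quadratic i =>
      rw [sub_eq_add_neg, ← map_neg]
      simp only [map_mul, map_add, map_zero, AlgHom.commutes, lift_freeT,
        MulOpposite.algebraMap_apply, ← op_add, ← op_mul]
      rw [heckeOp_quadratic q i, op_zero]
    | braid i j hi hij =>
      simp only [map_mul, lift_freeT, ← op_mul, ← mul_assoc]
      rw [heckeOp_braid q i j hi hij]
    | comm i j hij =>
      simp only [map_mul, lift_freeT, ← op_mul]
      rw [heckeOp_comm q i j hij]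
    | braidB i j hi hj =>
      simp only [map_mul, lift_freeT, ← op_mul, ← mul_assoc]
      rw [heckeOp_braidB q i j hi hj]
    | x_mul_up l σ j h =>
      simp only [map_mul, lift_freeX, ← op_mul, xOp]
      rw [topOp_mul q (by omega), HeckeB.perm_simpleRefl, HeckeB.perm_mul_up q σ j h]
    | x_mul_down l σ j h =>
      simp only [map_mul, map_add, map_smul, lift_freeX, ← op_mul, ← op_add, ← op_smul, xOp]
      rw [topOp_mul q (by omega), HeckeB.perm_simpleRefl, HeckeB.perm_mul_down q σ j h, topOp_add,
        topOp_smul]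
    | mul_x_up l σ j h =>
      simp only [map_mul, lift_freeX, ← op_mul, xOp]
      rw [topOp_mul q (by omega), HeckeB.perm_simpleRefl, HeckeB.mul_perm_up q σ j h]
    | mul_x_down l σ j h =>
      simp only [map_mul, map_add, map_smul, lift_freeX, ← op_mul, ← op_add, ← op_smul, xOp]
      rw [topOp_mul q (by omega), HeckeB.perm_simpleRefl, HeckeB.mul_perm_down q σ j h, topOp_add,
        topOp_smul]
    | x_orthogonal l k hlk σ γ =>
      simp only [map_mul, map_zero, lift_freeX, ← op_mul, xOp]
      rw [topOp_mul_ne q (by omega) (by omega) (fun h => hlk (Fin.ext h.symm)), op_zero]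
    | T_mul_x_lt l σ i j hij =>
      simp only [map_mul, lift_freeT, lift_freeX, ← op_mul, xOp]
      rw [HeckeB.perm_simpleRefl, topOp_mul_heckeOp_lt q (by omega) i j hij]
    | x_mul_T_lt l σ i j hij =>
      simp only [map_mul, lift_freeT, lift_freeX, ← op_mul, xOp]
      rw [HeckeB.perm_simpleRefl, heckeOp_mul_topOp_lt q (by omega) i j hij]
    | T_mul_x_gt l σ i hil =>
      simp only [map_mul, map_smul, lift_freeT, lift_freeX, ← op_mul, ← op_smul, xOp]
      rw [topOp_mul_heckeOp_gt q i hil]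
    | x_mul_T_gt l σ i hil =>
      simp only [map_mul, map_smul, lift_freeT, lift_freeX, ← op_mul, ← op_smul, xOp]
      rw [heckeOp_mul_topOp_gt q i hil]⟩

theorem Xi_T (i : Fin m) : Xi q r m (Duplex.T q i) = op (heckeOp q i) := by
  unfold Xi Duplex.T Duplex.mk
  exact (RingQuot.liftAlgHom_mkAlgHom_apply K _ _ _).trans (lift_freeT q i)

theorem Xi_x (l : Fin (m + 1)) (σ : Equiv.Perm (Fin l)) :
    Xi q r m (Duplex.x q l σ) = op (xOp q r m σ) := by
  unfold Xi Duplex.x Duplex.mk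
  exact (RingQuot.liftAlgHom_mkAlgHom_apply K _ _ _).trans (lift_freeX q l σ)

end Action

/-! ### Modules: right modules over `A` are modules over `Aᵐᵒᵖ` -/

section Modules

variable {K : Type*} [Field K] (q : Kˣ)

/-- The right `𝓗(B_l)`-module structure on the tensor power given by `Ψ`. -/
instance heckeModule (k l : ℕ) : Module (HeckeB q l)ᵐᵒᵖ (Tens K k l) :=
  Module.compHom (Tens K k l) (AlgHom.opComm (Psi q k l)).toRingHom

/-- The right module structure over the duplex Hecke algebra on `V̲^{⊗m}` given by `Ξ`. -/
instance duplexModule (r m : ℕ) : Module (Duplex q m)ᵐᵒᵖ (Tens K (r + 2) m) :=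
  Module.compHom (Tens K (r + 2) m) (AlgHom.opComm (Xi q r m)).toRingHom

theorem hecke_op_smul {k l : ℕ} (h : HeckeB q l) (v : Tens K k l) :
    op h • v = (Psi q k l h).unop v := rfl

theorem duplex_op_smul {r m : ℕ} (a : Duplex q m) (v : Tens K (r + 2) m) :
    op a • v = (Xi q r m a).unop v := rfl

instance (k l : ℕ) : IsScalarTower K (HeckeB q l)ᵐᵒᵖ (Tens K k l) where
  smul_assoc c a v := by
    induction a using MulOpposite.rec' with
    | _ h => rw [← op_smul, hecke_op_smul, hecke_op_smul, map_smul]; rfl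

instance (r m : ℕ) : IsScalarTower K (Duplex q m)ᵐᵒᵖ (Tens K (r + 2) m) where
  smul_assoc c a v := by
    induction a using MulOpposite.rec' with
    | _ h => rw [← op_smul, duplex_op_smul, duplex_op_smul, map_smul]; rfl

end Modules

/-! ### The modules `D^π_l` -/

/-- A decomposition of the module `M` as an internal direct sum of simple submodules. -/
def IsSimpleDecomposition {R M ι : Type*} [Ring R] [AddCommGroup M] [Module R M]
    (S : ι → Submodule R M) : Prop :=
  iSupIndep S ∧ ⨆ i, S i = ⊤ ∧ ∀ i, IsSimpleModule R (S i)

/-- The pairs `(I, J)` of disjoint subsets of the set of places with `#I = l`. -/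
abbrev PlacePair (m l : ℕ) : Type :=
  {p : Finset (Fin m) × Finset (Fin m) // p.1.card = l ∧ Disjoint p.1 p.2}

section Summands

variable {K : Type*} [Field K] (q : Kˣ)

/-- The span `V̲_{I,J}^{⊗m}` of the `M_f` such that `f(i)` is an index of `V` for `i ∈ I`, is
`-r - 3/2` for `i ∈ J` and is `r + 3/2` for the other `i`. -/
def tensIJ (K : Type*) [Field K] (r m : ℕ) (I J : Finset (Fin m)) :
    Submodule K (Tens K (r + 2) m) :=
  Submodule.span K (tensBasis K (r + 2) m '' {f | ∀ i,
    (i ∈ I → ∃ a : HalfInt (r + 1), f i = a.incl) ∧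
    (i ∈ J → f i = (topIndex r).neg) ∧
    (i ∉ I → i ∉ J → f i = topIndex r)})

/-- The first `l` places. -/
def firstPlaces (m l : ℕ) : Finset (Fin m) := Finset.univ.filter fun i => (i : ℕ) < l

/-- `ω` is an element of the duplex Hecke algebra of the kind `ω_{I,J}` with `#I = l`: a product of
the `T_i` and their inverses that takes `V̲_{I,J}^{⊗m}` onto
`V̲_{{1,…,l},∅}^{⊗m} = V^{⊗l} ⊗ η_{r+3/2}^{⊗(m-l)}`. -/
def IsTransport (r : ℕ) {m l : ℕ} (p : PlacePair m l) (ω : (Duplex q m)ˣ) : Prop :=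
  ω ∈ Subgroup.closure {u : (Duplex q m)ˣ | ∃ i : Fin m, (u : Duplex q m) = Duplex.T q i} ∧
    (tensIJ K r m p.1.1 p.1.2).map (Xi q r m (ω : Duplex q m)).unop =
      tensIJ K r m (firstPlaces m l) ∅

/-- `S_{I,J} = Ξ(ω⁻¹)(S ⊗ η_{r+3/2}^{⊗(m-l)})`, where `ω = ω_{I,J}`. -/
def summandIJ {r m l : ℕ} (ω : (Duplex q m)ˣ)
    (S : Submodule (HeckeB q l)ᵐᵒᵖ (Tens K (r + 1) l)) : Submodule K (Tens K (r + 2) m) :=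
  ((S.restrictScalars K).map (embTop K r m l)).map
    (Xi q r m ((ω⁻¹ : (Duplex q m)ˣ) : Duplex q m)).unop

/-- The sum `D = ∑_{I,J} S_{I,J}`. -/
def sumIJ {r m l : ℕ} (ω : PlacePair m l → (Duplex q m)ˣ)
    (S : Submodule (HeckeB q l)ᵐᵒᵖ (Tens K (r + 1) l)) : Submodule K (Tens K (r + 2) m) :=
  ⨆ p : PlacePair m l, summandIJ q (ω p) S

end Summands

end

end DuplexB

open DuplexB

namespace DuplexB

noncomputable section

open MulOpposite

/-! ### An invariant anisotropic bilinear form on tensor space -/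

section Form

/-! Sort the words f by the set I of places that carry a letter of V and the set J of places that
carry -r - 3/2. The M_f of one pair (I, J) span a block, and keeping only the letters on I, in their
order, identifies the block with V^{⊗l}, l = #I (`placeMap`, with `coordMap` as coordinate
projection). A letter of V lies strictly between the two extreme letters, so the order of two
letters of different kinds depends on the kinds alone. Hence T_i acts on a block as a generator of
𝓗(B_l), or as q⁻¹, or as the passage to another block with the same l plus c times the identity
(`heckeOp_placeMap`). In the last case c is 0 or q⁻¹ - q, so T_i or T_i⁻¹ = T_i - (q⁻¹ - q) is the
bare passage, and sorting the word leads from every block to that of the first l places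
(`linked_first`). This yields the ω_{I,J}.

For a submodule S of V^{⊗l} the sum of its copies in all blocks with #I = l (`spread`) is therefore
stable under the T_i. It is stable under x_σ^{(k)} as well, which sees only the block of the first k
places and acts there by H_σ. For every admissible ω_{I,J} the corresponding summand of D is the
copy of S in its block (`summandIJ_eq_map`), so D is `spread` whatever the choices, and directness
of the sums is read off from coordinates.

Semisimplicity of V^{⊗l} and simplicity of D rest on the symmetric form with orthonormal M_f, for
which the T_i are self-adjoint. As q is transcendental, K embeds in ℝ; so the form is anisotropic
and orthogonal complements split V^{⊗l}. A nonzero submodule N of the spread of a simple S cannot be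
orthogonal to the block of the first l places: the complement of N is stable under the T_i and would
contain all blocks with #I = l. Then x_1^{(l)}, the projection to that block, puts a nonzero vector
of the copy of S into N; irreducibility of S gives the whole copy, and transport gives all of D
(`isSimpleModule_spreadModule`). Complete reducibility follows from the decomposition into the D. -/

instance (k : ℕ) : Finite (HalfInt k) :=
  Set.Finite.to_subtype (s := {a : ℤ | Odd a ∧ |a| < 2 * (k : ℤ)})
    ((Set.finite_Ioo (-(2 * (k : ℤ))) (2 * (k : ℤ))).subset fun _ h => abs_lt.1 h.2)

instance (K : Type*) [Field K] (k m : ℕ) : Module.Finite K (Tens K k m) :=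
  Module.Finite.of_basis (tensBasis K k m)

/-- A field generated by one transcendental element embeds in every extension of the ground field
that has a transcendental element. -/
theorem nonempty_algHom_of_transcendental {F K L : Type*} [Field F] [Field K] [Field L]
    [Algebra F K] [Algebra F L] {x : K} {t : L} (hx : Transcendental F x)
    (hK : IntermediateField.adjoin F {x} = ⊤) (ht : Transcendental F t) : Nonempty (K →ₐ[F] L) :=
  ⟨(((IntermediateField.adjoin F {t}).val.comp
    (RatFunc.algEquivOfTranscendental t ht).toAlgHom).comp
    (RatFunc.algEquivOfTranscendental x hx).symm.toAlgHom).comp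
    ((IntermediateField.equivOfEq hK).symm.toAlgHom.comp
      IntermediateField.topEquiv.symm.toAlgHom)⟩

/-- Only the positivity of sums of squares in ℝ will be used, so any embedding serves; it sends q to
a Liouville number. Transcendence over ℤ passes to the fraction field ℚ. -/
theorem exists_ringHom_real {K : Type*} [Field K] [CharZero K] {q : K} (hq : Transcendental ℚ q)
    (hK : IntermediateField.adjoin ℚ {q} = ⊤) : Nonempty (K →+* ℝ) := by
  have ht : Transcendental ℚ (liouvilleNumber (2 : ℕ)) := fun h =>
    transcendental_liouvilleNumber le_rfl ((IsFractionRing.isAlgebraic_iff ℤ ℚ ℝ).2 h)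
  exact (nonempty_algHom_of_transcendental hq hK ht).map AlgHom.toRingHom

variable {K : Type*} [Field K] (q : Kˣ) {k m : ℕ}

open Classical in
/-- The symmetric bilinear form for which the `M_f` are orthonormal. -/
def tensForm (K : Type*) [Field K] (k m : ℕ) : LinearMap.BilinForm K (Tens K k m) :=
  (tensBasis K k m).toDual

open Classical in
theorem tensForm_basis (f g : Fin m → HalfInt k) :
    tensForm K k m (tensBasis K k m f) (tensBasis K k m g) = if f = g then 1 else 0 :=
  Module.Basis.toDual_apply _ _ _

theorem tensForm_basis_right (v : Tens K k m) (f : Fin m → HalfInt k) :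
    tensForm K k m v (tensBasis K k m f) = (tensBasis K k m).repr v f := by
  classical
  exact Module.Basis.toDual_apply_left _ _ _

theorem tensForm_comm (v w : Tens K k m) : tensForm K k m v w = tensForm K k m w v := by
  have h : tensForm K k m = (tensForm K k m).flip := by
    refine (tensBasis K k m).ext fun f => (tensBasis K k m).ext fun g => ?_
    exact (tensForm_basis f g).trans (((tensForm_basis g f).trans (by simp only [eq_comm])).symm)
  exact LinearMap.congr_fun (LinearMap.congr_fun h v) w

theorem tensForm_eq_sum [Fintype (Fin m → HalfInt k)] (v w : Tens K k m) :
    tensForm K k m v w =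
      ∑ f, (tensBasis K k m).repr v f * (tensBasis K k m).repr w f := by
  conv_lhs => rw [← (tensBasis K k m).sum_repr w]
  rw [map_sum]
  refine Finset.sum_congr rfl fun f _ => ?_
  rw [map_smul, tensForm_basis_right, smul_eq_mul, mul_comm]

/-- In an orthonormal basis the value at (v, v) is a sum of squares of coordinates; `φ` makes it a
sum of real squares, which vanishes only termwise. -/
theorem eq_zero_of_tensForm_self (φ : K →+* ℝ) (v : Tens K k m) (h : tensForm K k m v v = 0) :
    v = 0 := by
  have := Fintype.ofFinite (Fin m → HalfInt k)
  rw [tensForm_eq_sum] at h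
  have h2 := congrArg φ h
  simp only [map_sum, map_mul, map_zero] at h2
  rw [Finset.sum_eq_zero_iff_of_nonneg fun _ _ => mul_self_nonneg _] at h2
  refine (tensBasis K k m).ext_elem fun f => ?_
  have h3 := h2 f (Finset.mem_univ f)
  rw [mul_self_eq_zero, map_eq_zero] at h3
  simpa using h3

/-- An operator that fixes each plane spanned by `M_f` and `M_{s f}` and has a symmetric matrix
there is self-adjoint. -/
theorem tensForm_selfAdjoint_of_basis (T : Module.End K (Tens K k m))
    (s : (Fin m → HalfInt k) → Fin m → HalfInt k) (hs : ∀ f, s (s f) = f)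
    (c d : (Fin m → HalfInt k) → K) (hd : ∀ f, d (s f) = d f)
    (hT : ∀ f, T (tensBasis K k m f) = c f • tensBasis K k m f + d f • tensBasis K k m (s f))
    (v w : Tens K k m) : tensForm K k m (T v) w = tensForm K k m v (T w) := by
  classical
  have h : (tensForm K k m).comp T LinearMap.id = (tensForm K k m).comp LinearMap.id T := by
    refine (tensBasis K k m).ext fun f => (tensBasis K k m).ext fun g => ?_
    simp only [LinearMap.BilinForm.comp_apply, LinearMap.id_apply, hT, map_add, map_smul,
      LinearMap.add_apply, LinearMap.smul_apply, tensForm_basis, smul_eq_mul]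
    -- The second coefficients contribute at (f, g) and at (g, f) simultaneously because `s` is an
    -- involution; `hd` makes the two contributions equal.
    have e : s f = g ↔ f = s g := ⟨fun h => by rw [← h, hs], fun h => by rw [h, hs]⟩
    congr 1
    · split_ifs with h1
      · rw [h1]
      · simp
    · by_cases h1 : f = s g
      · rw [if_pos h1, if_pos (e.2 h1), h1, hd]
      · rw [if_neg h1, if_neg (mt e.1 h1), mul_zero, mul_zero]
  exact LinearMap.congr_fun (LinearMap.congr_fun h v) w

/-- A generator mixes only M_f and M_{f s_i}. Both off-diagonal entries are 1 and the asymmetric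
term q⁻¹ - q sits on the diagonal, so the matrix is symmetric. -/
theorem tensForm_heckeOp (i : Fin m) (v w : Tens K k m) :
    tensForm K k m (heckeOp q i v) w = tensForm K k m v (heckeOp q i w) := by
  classical
  rcases Nat.eq_zero_or_pos i with h | h
  · rw [heckeOp_zero q h]
    refine tensForm_selfAdjoint_of_basis _ (negAt i) (negAt_negAt i)
      (fun f => if 0 < (f i).1 then 0 else (q : K)⁻¹ - q) (fun _ => 1) (fun _ => rfl)
      (fun f => ?_) v w
    rcases lt_or_gt_of_ne (val_ne_zero (f i)) with h1 | h1
    · rw [negOp_neg q h1, if_neg (not_lt.2 h1.le), one_smul, add_comm]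
    · rw [negOp_pos q h1, if_pos h1, one_smul, zero_smul, zero_add]
  · rw [heckeOp_pos q h]
    set a : Fin m := ⟨i - 1, by omega⟩
    -- Where the two letters agree the exchange fixes the word; the eigenvalue q⁻¹ is then booked
    -- entirely as diagonal and the second coefficient is 0.
    refine tensForm_selfAdjoint_of_basis _ (swapAt a i) (swapAt_swapAt a i)
      (fun f => if (f a).1 = (f i).1 then (q : K)⁻¹ else if (f a).1 < (f i).1 then 0 else
        (q : K)⁻¹ - q) (fun f => if (f a).1 = (f i).1 then 0 else 1)
      (fun f => by simp only [swapAt_left, swapAt_right, eq_comm]) (fun f => ?_) v w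
    rcases lt_trichotomy (f a).1 (f i).1 with h1 | h1 | h1
    · rw [swapOp_lt q h1, if_neg h1.ne, if_pos h1, if_neg h1.ne, one_smul, zero_smul, zero_add]
    · rw [swapOp_eq q h1, if_pos h1, if_pos h1, zero_smul, add_zero]
    · rw [swapOp_gt q h1, if_neg h1.ne', if_neg (not_lt.2 h1.le), if_neg h1.ne', one_smul,
        add_comm]

end Form

/-! ### Semisimplicity of the tensor powers over the Hecke algebra -/

section Closure

variable {K : Type*} [Field K] (q : Kˣ)

/-- Every element is the image of a noncommutative polynomial in the generators. The action is from
the right, so in a product the left factor acts first. -/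
theorem Psi_mem {k l : ℕ} {U : Submodule K (Tens K k l)}
    (hU : ∀ i : Fin l, ∀ v ∈ U, heckeOp q i v ∈ U) (h : HeckeB q l) :
    ∀ v ∈ U, (Psi q k l h).unop v ∈ U := by
  obtain ⟨x, rfl⟩ : ∃ x, HeckeB.mk q l x = h := RingQuot.mkAlgHom_surjective K _ h
  induction x using FreeAlgebra.induction with
  | grade0 c =>
    intro v hv
    rw [AlgHom.commutes, AlgHom.commutes]
    exact U.smul_mem c hv
  | grade1 i =>
    intro v hv
    have := Psi_H q (k := k) i
    unfold HeckeB.H at this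
    rw [this]
    exact hU i v hv
  | mul a b ha hb =>
    intro v hv
    rw [map_mul, map_mul, unop_mul]
    exact hb _ (ha _ hv)
  | add a b ha hb =>
    intro v hv
    rw [map_add, map_add, unop_add]
    exact U.add_mem (ha _ hv) (hb _ hv)

/-- The submodule over the Hecke algebra given by a subspace closed under the generators. -/
def heckeSubmodule {k l : ℕ} (U : Submodule K (Tens K k l))
    (hU : ∀ i : Fin l, ∀ v ∈ U, heckeOp q i v ∈ U) : Submodule (HeckeB q l)ᵐᵒᵖ (Tens K k l) :=
  { U with smul_mem' := fun a v hv => Psi_mem q hU a.unop v hv }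

theorem heckeOp_mem {k l : ℕ} (N : Submodule (HeckeB q l)ᵐᵒᵖ (Tens K k l)) (i : Fin l)
    {v : Tens K k l} (hv : v ∈ N) : heckeOp q i v ∈ N := by
  have h := N.smul_mem (op (HeckeB.H q i)) hv
  rwa [hecke_op_smul, Psi_H] at h

/-- The orthogonal complement is the required one: anisotropy makes it disjoint from `N`, finite
dimension makes it a complement, self-adjointness of the generators makes it a submodule. -/
theorem isSemisimpleModule_hecke (φ : K →+* ℝ) (k l : ℕ) :
    IsSemisimpleModule (HeckeB q l)ᵐᵒᵖ (Tens K k l) where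
  exists_isCompl N := by
    let N₀ := N.restrictScalars K
    have hdisj : Disjoint N₀ ((tensForm K k l).orthogonal N₀) := by
      rw [Submodule.disjoint_def]
      exact fun v hv hv' => eq_zero_of_tensForm_self φ v (hv' v hv)
    have hrefl : (tensForm K k l).IsRefl := fun v w h => by rw [tensForm_comm, h]
    have hc := (LinearMap.BilinForm.isCompl_orthogonal_iff_disjoint hrefl).2 hdisj
    refine ⟨heckeSubmodule q ((tensForm K k l).orthogonal N₀) fun i v hv n hn => ?_, ?_, ?_⟩
    · show tensForm K k l n (heckeOp q i v) = 0
      rw [← tensForm_heckeOp]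
      exact hv _ (heckeOp_mem q N i hn)
    · rw [Submodule.disjoint_def]
      intro v hv hv'
      exact Submodule.disjoint_def.1 hc.disjoint v hv hv'
    · rw [codisjoint_iff, eq_top_iff]
      intro v _
      obtain ⟨a, ha, b, hb, rfl⟩ := Submodule.mem_sup.1
        (hc.sup_eq_top ▸ Submodule.mem_top : v ∈ N₀ ⊔ (tensForm K k l).orthogonal N₀)
      exact Submodule.add_mem_sup ha hb

theorem exists_isSimpleDecomposition_hecke (φ : K →+* ℝ) (k l : ℕ) : ∃ (n : ℕ)
    (S : Fin n → Submodule (HeckeB q l)ᵐᵒᵖ (Tens K k l)), IsSimpleDecomposition S := by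
  have := isSemisimpleModule_hecke q φ k l
  have : IsNoetherian (HeckeB q l)ᵐᵒᵖ (Tens K k l) := isNoetherian_of_tower K inferInstance
  obtain ⟨s, hs, htop, hsimple⟩ :=
    IsSemisimpleModule.exists_sSupIndep_sSup_simples_eq_top (HeckeB q l)ᵐᵒᵖ (Tens K k l)
  have hind := (sSupIndep_iff s).1 hs
  -- An independent family of nonzero submodules of a Noetherian module is finite.
  have hfin : Finite s := WellFoundedGT.finite_of_iSupIndep hind fun S =>
    (Submodule.nontrivial_iff_ne_bot).1
      (@IsSimpleModule.nontrivial (HeckeB q l)ᵐᵒᵖ _ S.1 _ _ (hsimple _ S.2))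
  have e := (Finite.equivFin s).symm
  refine ⟨_, fun i => (e i).1, hind.comp e.injective, ?_, fun i => hsimple _ (e i).2⟩
  rw [e.iSup_comp (g := fun i : s => i.1), ← sSup_eq_iSup', htop]

end Closure

/-! ### Words over the indices of V̲, sorted by the pair (I, J) -/

section Places

variable {r m l : ℕ}

instance (m l : ℕ) : Finite (PlacePair m l) := Subtype.finite

/-- The three kinds of letters: V̲ adds to V only the two extreme indices, which are the odd
integers ±(2r + 3) in the doubled notation. -/
theorem halfInt_cases (a : HalfInt (r + 2)) :
    (∃ b : HalfInt (r + 1), a = b.incl) ∨ a = (topIndex r).neg ∨ a = topIndex r := by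
  obtain ⟨a, hodd, ha⟩ := a
  rw [abs_lt] at ha
  push_cast at ha
  obtain ⟨c, rfl⟩ := hodd
  by_cases h1 : 2 * c + 1 = 2 * (r : ℤ) + 3
  · exact Or.inr (Or.inr (Subtype.ext h1))
  by_cases h2 : 2 * c + 1 = -(2 * (r : ℤ) + 3)
  · exact Or.inr (Or.inl (Subtype.ext h2))
  · refine Or.inl ⟨⟨2 * c + 1, ⟨c, rfl⟩, ?_⟩, rfl⟩
    rw [abs_lt]
    push_cast
    omega

theorem incl_injective : Function.Injective (HalfInt.incl (r := r)) :=
  fun a b h => Subtype.ext (show a.incl.1 = b.incl.1 from congrArg Subtype.val h)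

theorem val_topIndex : (topIndex r).1 = 2 * r + 3 := rfl

theorem val_neg_topIndex : (topIndex r).neg.1 = -(2 * r + 3) := rfl

theorem neg_top_lt_incl (a : HalfInt (r + 1)) : -(2 * r + 3) < a.1 := by
  have := a.2.2
  rw [abs_lt] at this
  push_cast at this
  omega

theorem neg_topIndex_ne : (topIndex r).neg ≠ topIndex r := fun h => by
  have := congrArg Subtype.val h
  rw [val_topIndex, val_neg_topIndex] at this
  omega

theorem incl_ne_topIndex (a : HalfInt (r + 1)) : a.incl ≠ topIndex r := fun h => by
  have := congrArg Subtype.val h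
  rw [val_topIndex, incl_val] at this
  exact (incl_lt_top a).ne this

theorem incl_ne_neg_topIndex (a : HalfInt (r + 1)) : a.incl ≠ (topIndex r).neg := fun h => by
  have := congrArg Subtype.val h
  rw [val_neg_topIndex, incl_val] at this
  exact (neg_top_lt_incl a).ne' this

theorem neg_neg_index {k : ℕ} (a : HalfInt k) : a.neg.neg = a := Subtype.ext (neg_neg a.1)

/-- The increasing enumeration of the first set of a pair `(I, J)`. -/
def PlacePair.enum (p : PlacePair m l) : Fin l ↪o Fin m := p.1.1.orderEmbOfFin p.2.1

theorem PlacePair.enum_mem (p : PlacePair m l) (j : Fin l) : p.enum j ∈ p.1.1 :=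
  Finset.orderEmbOfFin_mem _ _ _

theorem PlacePair.exists_enum (p : PlacePair m l) {i : Fin m} (hi : i ∈ p.1.1) :
    ∃ j, p.enum j = i := by
  have : i ∈ Set.range (p.1.1.orderEmbOfFin p.2.1) := by
    rw [Finset.range_orderEmbOfFin]; exact hi
  exact this

/-- Uniqueness of the increasing enumeration; it identifies the enumerations of the first `l` places
and of a pair with two neighbours exchanged. -/
theorem PlacePair.enum_eq (p : PlacePair m l) {e : Fin l → Fin m} (he : StrictMono e)
    (hmem : ∀ j, e j ∈ p.1.1) : ⇑p.enum = e :=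
  (Finset.orderEmbOfFin_unique p.2.1 hmem he).symm

open Classical in
/-- The word that has the letters of `g` on `I` in their order, `-r - 3/2` on `J`, and `r + 3/2`
at the other places. -/
def PlacePair.place (p : PlacePair m l) (g : Fin l → HalfInt (r + 1)) : Fin m → HalfInt (r + 2) :=
  fun i => if h : ∃ j, p.enum j = i then (g h.choose).incl
    else if i ∈ p.1.2 then (topIndex r).neg else topIndex r

namespace PlacePair

variable (p : PlacePair m l) (g : Fin l → HalfInt (r + 1))

theorem place_enum (j : Fin l) : p.place g (p.enum j) = (g j).incl := by
  have h : ∃ j', p.enum j' = p.enum j := ⟨j, rfl⟩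
  unfold place
  rw [dif_pos h, p.enum.injective h.choose_spec]

theorem notMem_left_of_mem_right {i : Fin m} (hi : i ∈ p.1.2) : i ∉ p.1.1 :=
  fun h => Finset.disjoint_left.1 p.2.2 h hi

theorem place_of_mem_right {i : Fin m} (hi : i ∈ p.1.2) : p.place g i = (topIndex r).neg := by
  have h : ¬ ∃ j, p.enum j = i := by
    rintro ⟨j, rfl⟩
    exact p.notMem_left_of_mem_right hi (p.enum_mem j)
  unfold place
  rw [dif_neg h, if_pos hi]

theorem place_of_notMem {i : Fin m} (hi : i ∉ p.1.1) (hi' : i ∉ p.1.2) :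
    p.place g i = topIndex r := by
  have h : ¬ ∃ j, p.enum j = i := by
    rintro ⟨j, rfl⟩
    exact hi (p.enum_mem j)
  unfold place
  rw [dif_neg h, if_neg hi']

variable {p g}

theorem eq_place {f : Fin m → HalfInt (r + 2)} (h1 : ∀ j, f (p.enum j) = (g j).incl)
    (h2 : ∀ i ∈ p.1.2, f i = (topIndex r).neg)
    (h3 : ∀ i, i ∉ p.1.1 → i ∉ p.1.2 → f i = topIndex r) : f = p.place g := by
  funext i
  by_cases hi : i ∈ p.1.1
  · obtain ⟨j, rfl⟩ := p.exists_enum hi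
    rw [h1, place_enum]
  by_cases hi' : i ∈ p.1.2
  · rw [h2 i hi', place_of_mem_right _ _ hi']
  · rw [h3 i hi hi', place_of_notMem _ _ hi hi']

theorem mem_left_iff_place {i : Fin m} :
    i ∈ p.1.1 ↔ p.place g i ≠ (topIndex r).neg ∧ p.place g i ≠ topIndex r := by
  by_cases hi : i ∈ p.1.1
  · obtain ⟨j, rfl⟩ := p.exists_enum hi
    rw [place_enum]
    exact iff_of_true hi ⟨incl_ne_neg_topIndex _, incl_ne_topIndex _⟩
  refine iff_of_false hi fun h => ?_
  by_cases hi' : i ∈ p.1.2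
  · exact h.1 (place_of_mem_right _ _ hi')
  · exact h.2 (place_of_notMem _ _ hi hi')

theorem mem_right_iff_place {i : Fin m} : i ∈ p.1.2 ↔ p.place g i = (topIndex r).neg := by
  refine ⟨place_of_mem_right _ _, fun h => ?_⟩
  by_contra hi'
  by_cases hi : i ∈ p.1.1
  · exact (mem_left_iff_place.1 hi).1 h
  · rw [place_of_notMem _ _ hi hi'] at h
    exact neg_topIndex_ne h.symm

theorem place_injective (p : PlacePair m l) : Function.Injective (p.place (r := r)) := by
  intro g g' h
  funext j
  have := congrFun h (p.enum j)
  rw [place_enum, place_enum] at this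
  exact incl_injective this

/-- Both sets can be read off from the word, by the places of the extreme letters. As `l` and `l'`
may differ, only the underlying pairs of sets are compared. -/
theorem eq_of_place_eq {l' : ℕ} {p' : PlacePair m l'} {g' : Fin l' → HalfInt (r + 1)}
    (h : p.place g = p'.place g') : p.1 = p'.1 := by
  refine Prod.ext (Finset.ext fun i => ?_) (Finset.ext fun i => ?_)
  · rw [mem_left_iff_place (g := g), mem_left_iff_place (g := g'), h]
  · rw [mem_right_iff_place (g := g), mem_right_iff_place (g := g'), h]

/-- With `eq_of_place_eq` and `place_injective` this splits the basis of V̲^{⊗m} into disjoint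
blocks, one for each (I, J). -/
theorem exists_place (f : Fin m → HalfInt (r + 2)) :
    ∃ (l : ℕ) (p : PlacePair m l) (g : Fin l → HalfInt (r + 1)), f = p.place g := by
  classical
  let I : Finset (Fin m) := Finset.univ.filter fun i => ∃ a : HalfInt (r + 1), f i = a.incl
  let J : Finset (Fin m) := Finset.univ.filter fun i => f i = (topIndex r).neg
  have hI : ∀ i, i ∈ I ↔ ∃ a : HalfInt (r + 1), f i = a.incl := fun i => by simp [I]
  have hJ : ∀ i, i ∈ J ↔ f i = (topIndex r).neg := fun i => by simp [J]
  have hd : Disjoint I J := Finset.disjoint_left.2 fun i h1 h2 => by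
    obtain ⟨a, ha⟩ := (hI i).1 h1
    exact incl_ne_neg_topIndex a (ha.symm.trans ((hJ i).1 h2))
  let p : PlacePair m I.card := ⟨(I, J), rfl, hd⟩
  choose g hg using fun j : Fin I.card => (hI _).1 (p.enum_mem j)
  refine ⟨_, p, g, eq_place hg (fun i hi => (hJ i).1 hi) fun i hi hi' => ?_⟩
  rcases halfInt_cases (f i) with h | h | h
  · exact absurd ((hI i).2 h) hi
  · exact absurd ((hJ i).2 h) hi'
  · exact h

theorem card_le (p : PlacePair m l) : l ≤ m := by
  have := Finset.card_le_univ p.1.1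
  rwa [p.2.1, Fintype.card_fin] at this

theorem range_place (p : PlacePair m l) : Set.range (p.place (r := r)) = {f | ∀ i,
    (i ∈ p.1.1 → ∃ a : HalfInt (r + 1), f i = a.incl) ∧
    (i ∈ p.1.2 → f i = (topIndex r).neg) ∧ (i ∉ p.1.1 → i ∉ p.1.2 → f i = topIndex r)} := by
  ext f
  constructor
  · rintro ⟨g, rfl⟩ i
    refine ⟨fun hi => ?_, place_of_mem_right _ _, place_of_notMem _ _⟩
    obtain ⟨j, rfl⟩ := p.exists_enum hi
    exact ⟨g j, place_enum _ _ _⟩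
  · intro h
    choose g hg using fun j : Fin l => (h _).1 (p.enum_mem j)
    exact ⟨g, (eq_place hg (fun i hi => (h i).2.1 hi) fun i => (h i).2.2).symm⟩

/-- Consecutive places in `I` have consecutive numbers in the enumeration. -/
theorem enum_succ {j j' : Fin l} (h : (p.enum j' : ℕ) = p.enum j + 1) : (j' : ℕ) = j + 1 := by
  have h1 : j < j' := p.enum.lt_iff_lt.1 (Fin.lt_def.2 (by omega))
  rw [Fin.lt_def] at h1
  by_contra hne
  have h2 := p.enum.lt_iff_lt.2 (show j < ⟨j + 1, by omega⟩ by simp [Fin.lt_def])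
  have h3 := p.enum.lt_iff_lt.2 (show (⟨j + 1, by omega⟩ : Fin l) < j' by
    rw [Fin.lt_def]; show (j : ℕ) + 1 < j'; omega)
  rw [Fin.lt_def] at h2 h3
  omega

/-- The first place, if it is in I, is the least element of I; so T_0 acts on such a block as H_0.
-/
theorem enum_zero {j : Fin l} (h : (p.enum j : ℕ) = 0) : (j : ℕ) = 0 := by
  by_contra hne
  have h2 := p.enum.lt_iff_lt.2 (show (⟨0, by omega⟩ : Fin l) < j by
    rw [Fin.lt_def]; show 0 < (j : ℕ); omega)
  rw [Fin.lt_def] at h2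
  omega

/-- The pair of the first `l` places and the empty set. -/
def first (hl : l ≤ m) : PlacePair m l :=
  ⟨(firstPlaces m l, ∅), by
    rw [firstPlaces, Fin.card_filter_val_lt, min_eq_right hl], Finset.disjoint_empty_right _⟩

theorem first_enum (hl : l ≤ m) (j : Fin l) : (first hl).enum j = ⟨j, j.2.trans_le hl⟩ :=
  congrFun ((first hl).enum_eq (e := fun j => ⟨j, j.2.trans_le hl⟩) (fun _ _ h => h)
    fun j => by simp [first, firstPlaces]) j

theorem first_place (hl : l ≤ m) (g : Fin l → HalfInt (r + 1)) :
    (first hl).place g = extendTop m g := by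
  refine (eq_place (p := first hl) (fun j => ?_) (fun i hi => ?_) fun i hi _ => ?_).symm
  · rw [first_enum, extendTop_of_lt (m := m) g ⟨j, by omega⟩ j.2]
  · simp [first] at hi
  · rw [extendTop_of_ge]
    simpa [first, firstPlaces] using hi

/-- The pair with the places `a` and `b` exchanged. -/
def swap (a b : Fin m) (p : PlacePair m l) : PlacePair m l :=
  ⟨(p.1.1.map (Equiv.swap a b).toEmbedding, p.1.2.map (Equiv.swap a b).toEmbedding),
    by rw [Finset.card_map, p.2.1], (Finset.disjoint_map _).2 p.2.2⟩

theorem mem_swap_left {a b i : Fin m} : i ∈ (p.swap a b).1.1 ↔ Equiv.swap a b i ∈ p.1.1 := by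
  simp [swap, Finset.mem_map_equiv]

theorem mem_swap_right {a b i : Fin m} : i ∈ (p.swap a b).1.2 ↔ Equiv.swap a b i ∈ p.1.2 := by
  simp [swap, Finset.mem_map_equiv]

/-- Exchanging neighbours reverses the order of no pair but (a, b), which is not contained in I. The
letters of V thus keep their order, and the same `g` describes the word before and after. -/
theorem swap_enum {a b : Fin m} (hab : (b : ℕ) = a + 1) (h : ¬ (a ∈ p.1.1 ∧ b ∈ p.1.1))
    (j : Fin l) : (p.swap a b).enum j = Equiv.swap a b (p.enum j) := by
  refine congrFun ((p.swap a b).enum_eq (e := fun j => Equiv.swap a b (p.enum j)) ?_ fun j => ?_) j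
  · intro j j' hj
    have h1 := Fin.lt_def.1 (p.enum.lt_iff_lt.2 hj)
    have h2 : ¬ (p.enum j = a ∧ p.enum j' = b) := fun ⟨ha, hb⟩ =>
      h ⟨ha ▸ p.enum_mem j, hb ▸ p.enum_mem j'⟩
    show Equiv.swap a b (p.enum j) < Equiv.swap a b (p.enum j')
    simp only [Fin.ext_iff] at h2
    simp only [Equiv.swap_apply_def, Fin.ext_iff, Fin.lt_def]
    split_ifs <;> omega
  · rw [mem_swap_left, Equiv.swap_apply_self]
    exact p.enum_mem j

theorem swapAt_place {a b : Fin m} (hab : (b : ℕ) = a + 1) (h : ¬ (a ∈ p.1.1 ∧ b ∈ p.1.1)) :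
    swapAt a b (p.place g) = (p.swap a b).place g := by
  refine eq_place (fun j => ?_) (fun i hi => ?_) fun i hi hi' => ?_
  · rw [swap_enum hab h]
    simp only [swapAt, Function.comp_apply, Equiv.swap_apply_self, place_enum]
  · exact place_of_mem_right _ _ (mem_swap_right.1 hi)
  · exact place_of_notMem _ _ (mt mem_swap_left.2 hi) (mt mem_swap_right.2 hi')

theorem swapAt_place_enum {j j' : Fin l} :
    swapAt (p.enum j) (p.enum j') (p.place g) = p.place (swapAt j j' g) := by
  refine eq_place (fun i => ?_) (fun i hi => ?_) fun i hi hi' => ?_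
  · have : Equiv.swap (p.enum j) (p.enum j') (p.enum i) = p.enum (Equiv.swap j j' i) := by
      simp only [Equiv.swap_apply_def, p.enum.injective.eq_iff]
      split_ifs <;> rfl
    simp only [swapAt, Function.comp_apply, this, place_enum]
  · have h := p.notMem_left_of_mem_right hi
    rw [swapAt_of_ne _ (fun e => h (by rw [e]; exact p.enum_mem j))
      (fun e => h (by rw [e]; exact p.enum_mem j')), place_of_mem_right _ _ hi]
  · rw [swapAt_of_ne _ (fun e => hi (by rw [e]; exact p.enum_mem j))
      (fun e => hi (by rw [e]; exact p.enum_mem j')), place_of_notMem _ _ hi hi']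

/-- The pair with the sign of the place `a ∉ I` changed. -/
def flip (a : Fin m) (p : PlacePair m l) (ha : a ∉ p.1.1) : PlacePair m l :=
  ⟨(p.1.1, symmDiff p.1.2 {a}), p.2.1, Finset.disjoint_left.2 fun i hi hi' => by
    rw [Finset.mem_symmDiff, Finset.mem_singleton] at hi'
    rcases hi' with h | h
    · exact Finset.disjoint_left.1 p.2.2 hi h.1
    · exact ha (h.1 ▸ hi)⟩

theorem mem_flip_right {a i : Fin m} {ha : a ∉ p.1.1} :
    i ∈ (p.flip a ha).1.2 ↔ (i ∈ p.1.2 ∧ i ≠ a ∨ i = a ∧ i ∉ p.1.2) := by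
  simp only [flip, Finset.mem_symmDiff, Finset.mem_singleton, ne_eq]

/-- Negation exchanges the two extreme letters, so it only toggles whether `a` belongs to J. -/
theorem negAt_place {a : Fin m} (ha : a ∉ p.1.1) :
    negAt a (p.place g) = (p.flip a ha).place g := by
  refine eq_place (fun j => ?_) (fun i hi => ?_) fun i hi hi' => ?_
  · show negAt a (p.place g) (p.enum j) = _
    rw [negAt_of_ne _ (fun e => ha (by rw [← e]; exact p.enum_mem j)), place_enum]
  · rcases mem_flip_right.1 hi with ⟨h1, h2⟩ | ⟨rfl, h2⟩
    · rw [negAt_of_ne _ h2, place_of_mem_right _ _ h1]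
    · simp [negAt, place_of_notMem _ _ ha h2]
  · rw [mem_flip_right] at hi'
    by_cases h : i = a
    · subst h
      have : i ∈ p.1.2 := by tauto
      simp [negAt, place_of_mem_right _ _ this, neg_neg_index]
    · rw [negAt_of_ne _ h, p.place_of_notMem g hi (by tauto)]

theorem negAt_place_enum {j : Fin l} :
    negAt (p.enum j) (p.place g) = p.place (negAt j g) := by
  refine eq_place (fun i => ?_) (fun i hi => ?_) fun i hi hi' => ?_
  · by_cases h : i = j
    · subst h
      simp only [negAt, Function.update_self, place_enum]
      rfl
    · rw [negAt_of_ne _ (p.enum.injective.ne h), negAt_of_ne _ h, place_enum]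
  · rw [negAt_of_ne _ fun e => p.notMem_left_of_mem_right hi (by rw [e]; exact p.enum_mem j),
      place_of_mem_right _ _ hi]
  · rw [negAt_of_ne _ fun e => hi (by rw [e]; exact p.enum_mem j), place_of_notMem _ _ hi hi']

theorem val_place_of_mem_right {i : Fin m} (hi : i ∈ p.1.2) :
    (p.place g i).1 = -(2 * r + 3) := by
  rw [place_of_mem_right _ _ hi, val_neg_topIndex]

theorem val_place_of_notMem {i : Fin m} (hi : i ∉ p.1.1) (hi' : i ∉ p.1.2) :
    (p.place g i).1 = 2 * r + 3 := by
  rw [place_of_notMem _ _ hi hi', val_topIndex]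

/-- With the two preceding values: the order of two letters of different kinds does not depend on
`g`. -/
theorem val_place_of_mem_left {i : Fin m} (hi : i ∈ p.1.1) :
    -(2 * r + 3) < (p.place g i).1 ∧ (p.place g i).1 < 2 * r + 3 := by
  obtain ⟨j, rfl⟩ := p.exists_enum hi
  rw [place_enum, incl_val]
  exact ⟨neg_top_lt_incl _, incl_lt_top _⟩

end PlacePair

end Places

/-! ### The copies of V^{⊗l} in V̲^{⊗m} and the generators on them -/

section PlaceMap

variable {K : Type*} [Field K] (q : Kˣ) {r m l : ℕ}

/-- The embedding of `V^{⊗l}` in `V̲^{⊗m}` with image `V̲_{I,J}^{⊗m}`. -/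
def placeMap (K : Type*) [Field K] {r m l : ℕ} (p : PlacePair m l) :
    Tens K (r + 1) l →ₗ[K] Tens K (r + 2) m :=
  (tensBasis K (r + 1) l).constr K fun g => tensBasis K (r + 2) m (p.place g)

/-- The projection of `V̲^{⊗m}` to `V^{⊗l}` along the `V̲_{I',J'}^{⊗m}` with
`(I', J') ≠ (I, J)`. -/
def coordMap (K : Type*) [Field K] {r m l : ℕ} (p : PlacePair m l) :
    Tens K (r + 2) m →ₗ[K] Tens K (r + 1) l :=
  (tensBasis K (r + 1) l).repr.symm.toLinearMap ∘ₗ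
    Finsupp.lcomapDomain p.place p.place_injective ∘ₗ (tensBasis K (r + 2) m).repr.toLinearMap

theorem placeMap_basis (p : PlacePair m l) (g : Fin l → HalfInt (r + 1)) :
    placeMap K p (tensBasis K (r + 1) l g) = tensBasis K (r + 2) m (p.place g) :=
  Module.Basis.constr_basis _ _ _ _

theorem repr_coordMap (p : PlacePair m l) (v : Tens K (r + 2) m) (g : Fin l → HalfInt (r + 1)) :
    (tensBasis K (r + 1) l).repr (coordMap K p v) g =
      (tensBasis K (r + 2) m).repr v (p.place g) := by
  simp [coordMap, Finsupp.lcomapDomain]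

theorem coordMap_placeMap (p : PlacePair m l) (v : Tens K (r + 1) l) :
    coordMap K p (placeMap K p v) = v := by
  have h : coordMap K p ∘ₗ placeMap K p = LinearMap.id (M := Tens K (r + 1) l) := by
    classical
    refine (tensBasis K (r + 1) l).ext fun g => (tensBasis K (r + 1) l).ext_elem fun g' => ?_
    rw [LinearMap.comp_apply, placeMap_basis, repr_coordMap, LinearMap.id_apply,
      Module.Basis.repr_self, Module.Basis.repr_self, Finsupp.single_apply, Finsupp.single_apply]
    simp only [p.place_injective.eq_iff]
  exact LinearMap.congr_fun h v

theorem coordMap_placeMap_ne {l' : ℕ} {p : PlacePair m l} {p' : PlacePair m l'} (h : p.1 ≠ p'.1)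
    (v : Tens K (r + 1) l') : coordMap K p (placeMap K p' v) = 0 := by
  have h : coordMap K p ∘ₗ placeMap K p' = (0 : Tens K (r + 1) l' →ₗ[K] Tens K (r + 1) l) := by
    classical
    refine (tensBasis K (r + 1) l').ext fun g => (tensBasis K (r + 1) l).ext_elem fun g' => ?_
    rw [LinearMap.comp_apply, placeMap_basis, repr_coordMap, LinearMap.zero_apply,
      Module.Basis.repr_self, Finsupp.single_apply,
      if_neg fun e => h (PlacePair.eq_of_place_eq e).symm]
    simp
  exact LinearMap.congr_fun h v

/-- Every basis word lies in some block, so the block coordinates together contain all coefficients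
of `v`. -/
theorem eq_zero_of_coordMap {v : Tens K (r + 2) m}
    (h : ∀ (l : ℕ) (p : PlacePair m l), coordMap K p v = 0) : v = 0 := by
  refine (tensBasis K (r + 2) m).ext_elem fun f => ?_
  obtain ⟨l, p, g, rfl⟩ := PlacePair.exists_place f
  rw [← repr_coordMap, h]
  simp

theorem embTop_eq_placeMap (hl : l ≤ m) : embTop K r m l = placeMap K (PlacePair.first hl) :=
  (tensBasis K (r + 1) l).ext fun g => by
    rw [embTop_basis, placeMap_basis, PlacePair.first_place]

/-- Consequently the operator of x_σ^{(l)} depends only on the coordinate in the block of the first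
`l` places. -/
theorem projTop_eq_coordMap (hl : l ≤ m) : projTop K r m l = coordMap K (PlacePair.first hl) := by
  refine (tensBasis K (r + 2) m).ext fun f => ?_
  by_cases h : ∃ g : Fin l → HalfInt (r + 1), extendTop m g = f
  · obtain ⟨g, rfl⟩ := h
    rw [projTop_extend hl, ← PlacePair.first_place hl, ← placeMap_basis, coordMap_placeMap]
  · rw [projTop_of_not h]
    refine (tensBasis K (r + 1) l).ext_elem fun g => ?_
    rw [repr_coordMap, Module.Basis.repr_self, PlacePair.first_place,
      Finsupp.single_eq_of_ne fun e => h ⟨g, e⟩]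
    simp

/-- The two maps are adjoint because `placeMap` sends an orthonormal basis to distinct members of
another. Thus a vanishing coordinate means orthogonality to the block. -/
theorem tensForm_placeMap (p : PlacePair m l) (v : Tens K (r + 2) m) (w : Tens K (r + 1) l) :
    tensForm K _ _ v (placeMap K p w) = tensForm K _ _ (coordMap K p v) w := by
  have h : (tensForm K (r + 2) m v) ∘ₗ placeMap K p = tensForm K (r + 1) l (coordMap K p v) := by
    refine (tensBasis K (r + 1) l).ext fun g => ?_
    rw [LinearMap.comp_apply, placeMap_basis, tensForm_basis_right, tensForm_basis_right,
      repr_coordMap]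
  exact LinearMap.congr_fun h w

theorem tensIJ_eq_range (p : PlacePair m l) :
    tensIJ K r m p.1.1 p.1.2 = LinearMap.range (placeMap K (r := r) p) := by
  unfold tensIJ placeMap
  rw [← PlacePair.range_place, ← Set.range_comp, Module.Basis.constr_range]
  rfl

theorem tensIJ_first (hl : l ≤ m) :
    tensIJ K r m (firstPlaces m l) ∅ = LinearMap.range (embTop K r m l) := by
  rw [embTop_eq_placeMap hl]
  exact tensIJ_eq_range (PlacePair.first hl)

/-- At places with letters of different kinds a generator permutes the `V̲_{I,J}^{⊗m}` up to a
multiple of the identity. -/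
theorem heckeOp_placeMap_of_kind_ne (p : PlacePair m l) {a b : Fin m} (hab : (b : ℕ) = a + 1)
    (hne : ¬ ((a ∈ p.1.1 ↔ b ∈ p.1.1) ∧ (a ∈ p.1.2 ↔ b ∈ p.1.2))) :
    ∃ c : K, (c = 0 ∨ c = (q : K)⁻¹ - q) ∧ ∀ v : Tens K (r + 1) l,
      heckeOp q b (placeMap K p v) = placeMap K (p.swap a b) v + c • placeMap K p v := by
  have hb : heckeOp (k := r + 2) q b = swapOp q a b := by
    rw [heckeOp_pos q (by omega)]
    congr 1
    exact Fin.ext (by simp [hab])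
  have hI : ¬ (a ∈ p.1.1 ∧ b ∈ p.1.1) := fun h => hne ⟨iff_of_true h.1 h.2,
    iff_of_false (fun h' => p.notMem_left_of_mem_right h' h.1)
      fun h' => p.notMem_left_of_mem_right h' h.2⟩
  -- The quantifiers over `g` stand inside the alternatives: the same branch of the rule applies to
  -- the whole block, which gives one scalar `c`.
  have key : (∀ g : Fin l → HalfInt (r + 1), (p.place g a).1 < (p.place g b).1) ∨
      ∀ g : Fin l → HalfInt (r + 1), (p.place g b).1 < (p.place g a).1 := by
    have hval : ∀ i : Fin m,
        (i ∈ p.1.1 ∧ i ∉ p.1.2 ∧ ∀ g : Fin l → HalfInt (r + 1),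
          -(2 * r + 3) < (p.place g i).1 ∧ (p.place g i).1 < 2 * r + 3) ∨
        (i ∉ p.1.1 ∧ i ∈ p.1.2 ∧ ∀ g : Fin l → HalfInt (r + 1),
          (p.place g i).1 = -(2 * r + 3)) ∨
        (i ∉ p.1.1 ∧ i ∉ p.1.2 ∧ ∀ g : Fin l → HalfInt (r + 1),
          (p.place g i).1 = 2 * r + 3) := by
      intro i
      by_cases hi' : i ∈ p.1.2
      · exact Or.inr (Or.inl ⟨p.notMem_left_of_mem_right hi', hi',
          fun g => PlacePair.val_place_of_mem_right hi'⟩)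
      by_cases hi : i ∈ p.1.1
      · exact Or.inl ⟨hi, hi', fun g => PlacePair.val_place_of_mem_left hi⟩
      · exact Or.inr (Or.inr ⟨hi, hi', fun g => PlacePair.val_place_of_notMem hi hi'⟩)
    rcases hval a with ⟨a1, a2, a3⟩ | ⟨a1, a2, a3⟩ | ⟨a1, a2, a3⟩ <;>
    rcases hval b with ⟨b1, b2, b3⟩ | ⟨b1, b2, b3⟩ | ⟨b1, b2, b3⟩ <;>
    first
    | (left; intro g; have := a3 g; have := b3 g; omega)
    | (right; intro g; have := a3 g; have := b3 g; omega)
    | (exfalso; tauto)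
  rcases key with key | key
  · refine ⟨0, Or.inl rfl, fun v => LinearMap.congr_fun (f := heckeOp q b ∘ₗ placeMap K p)
      (g := placeMap K (p.swap a b) + (0 : K) • placeMap K p)
      ((tensBasis K (r + 1) l).ext fun g => ?_) v⟩
    simp only [LinearMap.comp_apply, LinearMap.add_apply, LinearMap.smul_apply, placeMap_basis, hb]
    rw [swapOp_lt q (key g), PlacePair.swapAt_place hab hI, zero_smul, add_zero]
  · refine ⟨_, Or.inr rfl, fun v => LinearMap.congr_fun (f := heckeOp q b ∘ₗ placeMap K p)
      (g := placeMap K (p.swap a b) + ((q : K)⁻¹ - q) • placeMap K p)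
      ((tensBasis K (r + 1) l).ext fun g => ?_) v⟩
    simp only [LinearMap.comp_apply, LinearMap.add_apply, LinearMap.smul_apply, placeMap_basis, hb]
    rw [swapOp_gt q (key g), PlacePair.swapAt_place hab hI]

/-- The place `a` carries the same extreme letter throughout the block, and its sign decides between
the two values of `c`. -/
theorem heckeOp_placeMap_zero (p : PlacePair m l) {a : Fin m} (h0 : (a : ℕ) = 0)
    (ha : a ∉ p.1.1) :
    ∃ c : K, (c = 0 ∨ c = (q : K)⁻¹ - q) ∧ ∀ v : Tens K (r + 1) l,
      heckeOp q a (placeMap K p v) = placeMap K (p.flip a ha) v + c • placeMap K p v := by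
  by_cases hJ : a ∈ p.1.2
  · refine ⟨_, Or.inr rfl, fun v => LinearMap.congr_fun (f := heckeOp q a ∘ₗ placeMap K p)
      (g := placeMap K (p.flip a ha) + ((q : K)⁻¹ - q) • placeMap K p)
      ((tensBasis K (r + 1) l).ext fun g => ?_) v⟩
    simp only [LinearMap.comp_apply, LinearMap.add_apply, LinearMap.smul_apply, placeMap_basis,
      heckeOp_zero q h0]
    rw [negOp_neg q (by rw [PlacePair.val_place_of_mem_right hJ]; omega),
      PlacePair.negAt_place ha]
  · refine ⟨0, Or.inl rfl, fun v => LinearMap.congr_fun (f := heckeOp q a ∘ₗ placeMap K p)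
      (g := placeMap K (p.flip a ha) + (0 : K) • placeMap K p)
      ((tensBasis K (r + 1) l).ext fun g => ?_) v⟩
    simp only [LinearMap.comp_apply, LinearMap.add_apply, LinearMap.smul_apply, placeMap_basis,
      heckeOp_zero q h0]
    rw [negOp_pos q (by rw [PlacePair.val_place_of_notMem ha hJ]; omega),
      PlacePair.negAt_place ha, zero_smul, add_zero]

/-- The inclusion of indices preserves values, so both sides fall under the same branch of the rule.
-/
theorem swapOp_placeMap_enum (p : PlacePair m l) (j j' : Fin l) (v : Tens K (r + 1) l) :
    swapOp q (p.enum j) (p.enum j') (placeMap K p v) = placeMap K p (swapOp q j j' v) := by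
  refine LinearMap.congr_fun (f := swapOp q (p.enum j) (p.enum j') ∘ₗ placeMap K p)
    (g := placeMap K p ∘ₗ swapOp q j j') ((tensBasis K (r + 1) l).ext fun g => ?_) v
  have e : ∀ i, (p.place g (p.enum i)).1 = (g i).1 := fun i => by
    rw [PlacePair.place_enum, incl_val]
  rw [LinearMap.comp_apply, LinearMap.comp_apply, placeMap_basis]
  rcases lt_trichotomy (g j).1 (g j').1 with h | h | h
  · rw [swapOp_lt q (by rwa [e, e]), swapOp_lt q h, placeMap_basis, PlacePair.swapAt_place_enum]
  · rw [swapOp_eq q (by rwa [e, e]), swapOp_eq q h, map_smul, placeMap_basis]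
  · rw [swapOp_gt q (by rwa [e, e]), swapOp_gt q h, map_add, map_smul, placeMap_basis,
      placeMap_basis, PlacePair.swapAt_place_enum]

theorem negOp_placeMap_enum (p : PlacePair m l) (j : Fin l) (v : Tens K (r + 1) l) :
    negOp q (p.enum j) (placeMap K p v) = placeMap K p (negOp q j v) := by
  refine LinearMap.congr_fun (f := negOp q (p.enum j) ∘ₗ placeMap K p)
    (g := placeMap K p ∘ₗ negOp q j) ((tensBasis K (r + 1) l).ext fun g => ?_) v
  have e : (p.place g (p.enum j)).1 = (g j).1 := by rw [PlacePair.place_enum, incl_val]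
  rw [LinearMap.comp_apply, LinearMap.comp_apply, placeMap_basis]
  rcases lt_or_gt_of_ne (val_ne_zero (g j)) with h | h
  · rw [negOp_neg q (by rwa [e]), negOp_neg q h, map_add, map_smul, placeMap_basis,
      placeMap_basis, PlacePair.negAt_place_enum]
  · rw [negOp_pos q (by rwa [e]), negOp_pos q h, placeMap_basis, PlacePair.negAt_place_enum]

/-- For i > 0 the cases are: both places in I; both outside I with the same extreme letter; letters
of different kinds. For i = 0 only membership of the first place in I matters. In each case copies
of a submodule go into sums of copies of it. -/
theorem heckeOp_placeMap (p : PlacePair m l) (i : Fin m) :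
    (∃ j : Fin l, ∀ v : Tens K (r + 1) l,
      heckeOp q i (placeMap K p v) = placeMap K p (heckeOp q j v)) ∨
    (∀ v : Tens K (r + 1) l, heckeOp q i (placeMap K p v) = (q : K)⁻¹ • placeMap K p v) ∨
    ∃ (p' : PlacePair m l) (c : K), ∀ v : Tens K (r + 1) l,
      heckeOp q i (placeMap K p v) = placeMap K p' v + c • placeMap K p v := by
  rcases Nat.eq_zero_or_pos i with h | h
  · by_cases hi : i ∈ p.1.1
    · obtain ⟨j, rfl⟩ := p.exists_enum hi
      refine Or.inl ⟨j, fun v => ?_⟩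
      rw [heckeOp_zero q h, heckeOp_zero q (PlacePair.enum_zero h), negOp_placeMap_enum]
    · obtain ⟨c, -, hc⟩ := heckeOp_placeMap_zero q (r := r) p h hi
      exact Or.inr (Or.inr ⟨_, c, hc⟩)
  · obtain ⟨a, ha⟩ : ∃ a : Fin m, (i : ℕ) = a + 1 := ⟨⟨i - 1, by omega⟩, by simp; omega⟩
    have ea : (⟨i - 1, by omega⟩ : Fin m) = a := Fin.ext (by simp [ha])
    by_cases hk : (a ∈ p.1.1 ↔ i ∈ p.1.1) ∧ (a ∈ p.1.2 ↔ i ∈ p.1.2)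
    · by_cases hi : i ∈ p.1.1
      · obtain ⟨j, rfl⟩ := p.exists_enum hi
        obtain ⟨j', rfl⟩ := p.exists_enum (hk.1.2 hi)
        have hj := PlacePair.enum_succ ha
        refine Or.inl ⟨j, fun v => ?_⟩
        have ej : (⟨j - 1, by omega⟩ : Fin l) = j' := Fin.ext (by simp [hj])
        rw [heckeOp_pos q h, heckeOp_pos q (by omega), ea, ej, swapOp_placeMap_enum]
      · refine Or.inr (Or.inl fun v => ?_)
        refine LinearMap.congr_fun (f := heckeOp q i ∘ₗ placeMap K p)
          (g := (q : K)⁻¹ • placeMap K p) ((tensBasis K (r + 1) l).ext fun g => ?_) v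
        rw [LinearMap.comp_apply, LinearMap.smul_apply, placeMap_basis, heckeOp_pos q h, ea]
        apply swapOp_eq
        by_cases hi' : i ∈ p.1.2
        · rw [PlacePair.val_place_of_mem_right hi', PlacePair.val_place_of_mem_right (hk.2.2 hi')]
        · rw [PlacePair.val_place_of_notMem hi hi',
            PlacePair.val_place_of_notMem (mt hk.1.1 hi) (mt hk.2.1 hi')]
    · obtain ⟨c, -, hc⟩ := heckeOp_placeMap_of_kind_ne q (r := r) p ha hk
      exact Or.inr (Or.inr ⟨_, c, hc⟩)

theorem heckeOp_embTop (hl : l ≤ m) (j : Fin l) (v : Tens K (r + 1) l) :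
    heckeOp q (⟨j, j.2.trans_le hl⟩ : Fin m) (embTop K r m l v) =
      embTop K r m l (heckeOp q j v) := by
  rcases Nat.eq_zero_or_pos j with h | h
  · rw [embTop_eq_placeMap hl, ← PlacePair.first_enum hl, heckeOp_zero q, heckeOp_zero q h,
      negOp_placeMap_enum]
    rw [PlacePair.first_enum, ← h]
  · exact LinearMap.congr_fun (heckeOp_comp_embTop_lt q ⟨j, j.2.trans_le hl⟩ j h rfl) v

end PlaceMap

/-! ### Transport between blocks by products of the T_i and their inverses -/

section Transport

variable {K : Type*} [Field K] (q : Kˣ) {r m l : ℕ}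

theorem Duplex.T_mul_self (i : Fin m) :
    Duplex.T q i * Duplex.T q i = 1 + ((q : K)⁻¹ - (q : K)) • Duplex.T q i := by
  have h : (Duplex.T q i + algebraMap K _ (q : K)) *
      (Duplex.T q i - algebraMap K _ (q : K)⁻¹) = 0 := by
    have := RingQuot.mkAlgHom_rel K (DuplexRel.quadratic (q := q) i)
    change Duplex.mk q m _ = Duplex.mk q m _ at this
    simpa only [Duplex.T, map_mul, map_sub, map_add, map_zero, AlgHom.commutes] using this
  rw [mul_sub, add_mul, add_mul, ← map_mul, mul_inv_cancel₀ q.ne_zero, map_one,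
    ← Algebra.commutes, ← Algebra.smul_def, ← Algebra.smul_def] at h
  rw [sub_smul, ← sub_eq_zero, ← h]
  abel

/-- The generator `T_i` as a unit. -/
def Duplex.unitT (i : Fin m) : (Duplex q m)ˣ where
  val := Duplex.T q i
  inv := Duplex.T q i - ((q : K)⁻¹ - (q : K)) • 1
  val_inv := by
    rw [mul_sub, Duplex.T_mul_self, mul_smul_comm, mul_one, add_sub_cancel_right]
  inv_val := by
    rw [sub_mul, Duplex.T_mul_self, smul_mul_assoc, one_mul, add_sub_cancel_right]

theorem Xi_inv_apply (ω : (Duplex q m)ˣ) (v : Tens K (r + 2) m) :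
    (Xi q r m ((ω⁻¹ : (Duplex q m)ˣ) : Duplex q m)).unop ((Xi q r m (ω : Duplex q m)).unop v) =
      v := by
  rw [← Module.End.mul_apply, ← unop_mul, ← map_mul, Units.mul_inv, map_one]
  rfl

/-- The subgroup generated by the `T_i`. -/
abbrev Duplex.groupT (q : Kˣ) (m : ℕ) : Subgroup (Duplex q m)ˣ :=
  Subgroup.closure {u : (Duplex q m)ˣ | ∃ i : Fin m, (u : Duplex q m) = Duplex.T q i}

theorem Duplex.unitT_mem (i : Fin m) : Duplex.unitT q i ∈ Duplex.groupT q m :=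
  Subgroup.subset_closure ⟨i, rfl⟩

/-- Some element of the group generated by the `T_i` identifies `V̲_{I,J}^{⊗m}` and
`V̲_{I',J'}^{⊗m}` in the standard way. -/
def Linked (q : Kˣ) (r : ℕ) {m l : ℕ} (p p' : PlacePair m l) : Prop :=
  ∃ ω ∈ Duplex.groupT q m, ∀ v : Tens K (r + 1) l,
    (Xi q r m (ω : Duplex q m)).unop (placeMap K p v) = placeMap K p' v

theorem Linked.refl (p : PlacePair m l) : Linked q r p p :=
  ⟨1, one_mem _, fun v => by rw [Units.val_one, map_one]; rfl⟩

variable {q}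

theorem Linked.trans {p₁ p₂ p₃ : PlacePair m l} (h : Linked q r p₁ p₂) (h' : Linked q r p₂ p₃) :
    Linked q r p₁ p₃ := by
  obtain ⟨ω, hω, h⟩ := h
  obtain ⟨ω', hω', h'⟩ := h'
  refine ⟨ω * ω', mul_mem hω hω', fun v => ?_⟩
  rw [Units.val_mul, map_mul, unop_mul, Module.End.mul_apply, h, h']

/-- If c = 0 the generator T_i is the link; if c = q⁻¹ - q, then T_i⁻¹ = T_i - (q⁻¹ - q) cancels the
diagonal term. -/
theorem Linked.of_heckeOp {p p' : PlacePair m l} {i : Fin m}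
    (h : ∃ c : K, (c = 0 ∨ c = (q : K)⁻¹ - q) ∧ ∀ v : Tens K (r + 1) l,
      heckeOp q i (placeMap K p v) = placeMap K p' v + c • placeMap K p v) : Linked q r p p' := by
  obtain ⟨c, rfl | rfl, hc⟩ := h
  · refine ⟨Duplex.unitT q i, Duplex.unitT_mem q i, fun v => ?_⟩
    show (Xi q r m (Duplex.T q i)).unop _ = _
    rw [Xi_T, unop_op, hc, zero_smul, add_zero]
  · refine ⟨(Duplex.unitT q i)⁻¹, inv_mem (Duplex.unitT_mem q i), fun v => ?_⟩
    show (Xi q r m (Duplex.T q i - ((q : K)⁻¹ - (q : K)) • 1)).unop _ = _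
    rw [map_sub, map_smul, map_one, Xi_T, unop_sub, unop_smul, unop_op, unop_one,
      LinearMap.sub_apply, LinearMap.smul_apply, Module.End.one_apply, hc, add_sub_cancel_right]

variable (q)

open Classical in
/-- The weight of the letter that `(I, J)` has at the place `i` when it stands at the place `k`. -/
def PlacePair.weight (p : PlacePair m l) (i k : Fin m) : ℕ :=
  if i ∈ p.1.1 then 0 else if i ∈ p.1.2 then m + 1 + k else m - k

/-- The total weight, which decreases when `(I, J)` is sorted. -/
def PlacePair.totalWeight (p : PlacePair m l) : ℕ := ∑ i, p.weight i i

/-- After reindexing, each letter keeps its kind and only the place at which it is weighed moves, so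
weights can be compared letter by letter. -/
theorem PlacePair.totalWeight_swap (p : PlacePair m l) (a b : Fin m) :
    (p.swap a b).totalWeight = ∑ i, p.weight i (Equiv.swap a b i) := by
  unfold totalWeight
  rw [← Equiv.sum_comp (Equiv.swap a b)]
  refine Finset.sum_congr rfl fun i _ => ?_
  simp only [weight, mem_swap_left, mem_swap_right, Equiv.swap_apply_self]

/-- A pair without places in `J` and without a place outside `I` before a place in `I`. -/
theorem PlacePair.eq_first (p : PlacePair m l) (hJ : p.1.2 = ∅)
    (hI : ∀ a b : Fin m, (b : ℕ) = a + 1 → b ∈ p.1.1 → a ∈ p.1.1) :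
    p = PlacePair.first p.card_le := by
  have hdown : ∀ (n : ℕ) (a b : Fin m), (b : ℕ) = a + n → b ∈ p.1.1 → a ∈ p.1.1 := by
    intro n
    induction n with
    | zero => intro a b h hb; rwa [show a = b from Fin.ext (by omega)]
    | succ n ih =>
      intro a b h hb
      exact hI a ⟨a + 1, by omega⟩ rfl (ih _ b (by simp only; omega) hb)
  have hsub : p.1.1 ⊆ firstPlaces m l := by
    intro i hi
    -- The i + 1 places up to `i` all lie in I, which has `l` elements; hence i < l.
    have h1 : Finset.Iic i ⊆ p.1.1 := fun a ha => by
      have := Fin.le_def.1 (Finset.mem_Iic.1 ha)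
      exact hdown (i - a) a i (by omega) hi
    have h2 := Finset.card_le_card h1
    rw [Fin.card_Iic, p.2.1] at h2
    simp only [firstPlaces, Finset.mem_filter, Finset.mem_univ, true_and]
    omega
  refine Subtype.ext (Prod.ext (Finset.eq_of_subset_of_card_le hsub ?_) hJ)
  rw [p.2.1]
  exact (PlacePair.first p.card_le).2.1.le

/-- Sorting: letters -r - 3/2 move left, become r + 3/2 at the first place, and letters r + 3/2 move
right past those of V. The weights are chosen so that each of these moves lowers the total; the
induction stops at the sorted pair. -/
theorem linked_first (p : PlacePair m l) : Linked q r p (PlacePair.first p.card_le) := by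
  induction hn : p.totalWeight using Nat.strong_induction_on generalizing p with
  | _ n ih =>
  subst hn
  by_cases hJ : ∃ a b : Fin m, (b : ℕ) = a + 1 ∧ b ∈ p.1.2 ∧ a ∉ p.1.2
  · obtain ⟨a, b, hab, hb, ha⟩ := hJ
    have hb' := p.notMem_left_of_mem_right hb
    refine (Linked.of_heckeOp (heckeOp_placeMap_of_kind_ne q p hab fun h => ha (h.2.2 hb))).trans
      (ih _ ?_ _ rfl)
    rw [PlacePair.totalWeight_swap]
    refine Finset.sum_lt_sum (fun i _ => ?_) ⟨b, Finset.mem_univ _, ?_⟩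
    · by_cases h1 : i = a
      · subst h1
        simp only [PlacePair.weight, Equiv.swap_apply_left, if_neg ha]
        split_ifs <;> omega
      by_cases h2 : i = b
      · subst h2
        simp only [PlacePair.weight, Equiv.swap_apply_right, if_pos hb, if_neg hb']
        omega
      · rw [Equiv.swap_apply_of_ne_of_ne h1 h2]
    · simp only [PlacePair.weight, Equiv.swap_apply_right, if_pos hb, if_neg hb']
      omega
  by_cases h0 : ∃ a : Fin m, (a : ℕ) = 0 ∧ a ∈ p.1.2
  · obtain ⟨a, h0, ha⟩ := h0
    have ha' := p.notMem_left_of_mem_right ha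
    refine (Linked.of_heckeOp (heckeOp_placeMap_zero q p h0 ha')).trans (ih _ ?_ _ rfl)
    have hw : ∀ i, i ≠ a → (p.flip a ha').weight i i = p.weight i i := fun i hi => by
      have h1 : i ∈ (p.flip a ha').1.2 ↔ i ∈ p.1.2 := by
        rw [PlacePair.mem_flip_right]; tauto
      have h2 : i ∈ (p.flip a ha').1.1 ↔ i ∈ p.1.1 := Iff.rfl
      simp only [PlacePair.weight, h1, h2]
    -- At the first place the weight drops from m + 1 to m.
    have hwa : (p.flip a ha').weight a a < p.weight a a := by
      have h1 : a ∉ (p.flip a ha').1.2 := by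
        rw [PlacePair.mem_flip_right]; tauto
      have h2 : a ∉ (p.flip a ha').1.1 := ha'
      simp only [PlacePair.weight, if_neg h1, if_neg h2, if_neg ha', if_pos ha]
      omega
    refine Finset.sum_lt_sum (fun i _ => ?_) ⟨a, Finset.mem_univ _, hwa⟩
    by_cases h : i = a
    · subst h; exact hwa.le
    · exact (hw i h).le
  -- By `hJ` the set J is closed under passing to the preceding place, and by `h0` it misses the
  -- first place; so it is empty.
  have hJ' : ∀ (n : ℕ) (a : Fin m), (a : ℕ) = n → a ∉ p.1.2 := by
    intro n
    induction n with
    | zero => exact fun a ha h => h0 ⟨a, ha, h⟩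
    | succ n ih' =>
      exact fun a ha h => hJ ⟨⟨n, by omega⟩, a, ha, h, ih' _ rfl⟩
  by_cases hI : ∃ a b : Fin m, (b : ℕ) = a + 1 ∧ b ∈ p.1.1 ∧ a ∉ p.1.1
  · obtain ⟨a, b, hab, hb, ha⟩ := hI
    refine (Linked.of_heckeOp (heckeOp_placeMap_of_kind_ne q p hab fun h => ha (h.1.2 hb))).trans
      (ih _ ?_ _ rfl)
    rw [PlacePair.totalWeight_swap]
    refine Finset.sum_lt_sum (fun i _ => ?_) ⟨a, Finset.mem_univ _, ?_⟩
    · by_cases h1 : i = a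
      · subst h1
        simp only [PlacePair.weight, Equiv.swap_apply_left, if_neg ha, if_neg (hJ' _ _ rfl)]
        omega
      by_cases h2 : i = b
      · subst h2
        simp only [PlacePair.weight, if_pos hb, le_refl]
      · rw [Equiv.swap_apply_of_ne_of_ne h1 h2]
    · simp only [PlacePair.weight, Equiv.swap_apply_left, if_neg ha, if_neg (hJ' _ _ rfl)]
      omega
  · have h := p.eq_first (Finset.eq_empty_of_forall_notMem fun a => hJ' _ a rfl)
      fun a b hab hb => by_contra fun ha => hI ⟨a, b, hab, hb, ha⟩
    rw [← h]
    exact Linked.refl q p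

theorem exists_isTransport (r : ℕ) (p : PlacePair m l) :
    ∃ ω : (Duplex q m)ˣ, IsTransport q r p ω := by
  obtain ⟨ω, hω, h⟩ := linked_first q (r := r) p
  refine ⟨ω, hω, ?_⟩
  rw [tensIJ_first p.card_le, embTop_eq_placeMap p.card_le, tensIJ_eq_range, ← LinearMap.range_comp]
  congr 1
  exact LinearMap.ext h

end Transport

/-! ### The modules `spread`: independence of ω, simplicity, decomposition -/

section Summand

variable {K : Type*} [Field K] (q : Kˣ) {r m l : ℕ}

theorem Xi_mem {U : Submodule K (Tens K (r + 2) m)}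
    (hT : ∀ i : Fin m, ∀ v ∈ U, heckeOp q i v ∈ U)
    (hx : ∀ (k : Fin (m + 1)) (σ : Equiv.Perm (Fin k)), ∀ v ∈ U, xOp q r m σ v ∈ U)
    (a : Duplex q m) : ∀ v ∈ U, (Xi q r m a).unop v ∈ U := by
  obtain ⟨y, rfl⟩ : ∃ y, Duplex.mk q m y = a := RingQuot.mkAlgHom_surjective K _ a
  induction y using FreeAlgebra.induction with
  | grade0 c =>
    intro v hv
    rw [AlgHom.commutes, AlgHom.commutes]
    exact U.smul_mem c hv
  | grade1 g =>
    intro v hv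
    cases g with
    | T i =>
      have := Xi_T q (r := r) i
      unfold Duplex.T freeT at this
      rw [this]
      exact hT i v hv
    | x k σ =>
      have := Xi_x q (r := r) k σ
      unfold Duplex.x freeX at this
      rw [this]
      exact hx k σ v hv
  | mul a b ha hb =>
    intro v hv
    rw [map_mul, map_mul, unop_mul]
    exact hb _ (ha _ hv)
  | add a b ha hb =>
    intro v hv
    rw [map_add, map_add, unop_add]
    exact U.add_mem (ha _ hv) (hb _ hv)

/-- Stability under the x_σ^{(k)} is not required, so the statement applies to orthogonal
complements. Inverses cause no trouble, as T_i⁻¹ is a polynomial in T_i. -/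
theorem Xi_mem_of_mem_groupT {U : Submodule K (Tens K (r + 2) m)}
    (hT : ∀ i : Fin m, ∀ v ∈ U, heckeOp q i v ∈ U) {ω : (Duplex q m)ˣ}
    (hω : ω ∈ Duplex.groupT q m) : ∀ v ∈ U, (Xi q r m (ω : Duplex q m)).unop v ∈ U ∧
      (Xi q r m ((ω⁻¹ : (Duplex q m)ˣ) : Duplex q m)).unop v ∈ U := by
  induction hω using Subgroup.closure_induction with
  | mem u hu =>
    obtain ⟨i, hi⟩ := hu
    obtain rfl : u = Duplex.unitT q i := Units.ext hi
    intro v hv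
    have h := hT i v hv
    constructor
    · show (Xi q r m (Duplex.T q i)).unop v ∈ U
      rwa [Xi_T]
    · show (Xi q r m (Duplex.T q i - ((q : K)⁻¹ - (q : K)) • 1)).unop v ∈ U
      rw [map_sub, map_smul, map_one, Xi_T]
      exact U.sub_mem h (U.smul_mem _ hv)
  | one =>
    intro v hv
    rw [inv_one, Units.val_one, map_one]
    exact ⟨hv, hv⟩
  | mul a b _ _ ha hb =>
    intro v hv
    rw [mul_inv_rev, Units.val_mul, Units.val_mul, map_mul, map_mul, unop_mul, unop_mul]
    exact ⟨(hb _ (ha _ hv).1).1, (ha _ (hb _ hv).2).2⟩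
  | inv a _ ha =>
    intro v hv
    rw [inv_inv]
    exact (ha v hv).symm

/-- The sum of the copies of `S ⊆ V^{⊗l}` in the `V̲_{I,J}^{⊗m}` with `#I = l`. -/
def spread (m : ℕ) (S : Submodule (HeckeB q l)ᵐᵒᵖ (Tens K (r + 1) l)) :
    Submodule K (Tens K (r + 2) m) :=
  ⨆ p : PlacePair m l, (S.restrictScalars K).map (placeMap K p)

variable {q} {S : Submodule (HeckeB q l)ᵐᵒᵖ (Tens K (r + 1) l)}

theorem placeMap_mem_spread (p : PlacePair m l) {v : Tens K (r + 1) l} (hv : v ∈ S) :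
    placeMap K p v ∈ spread q m S :=
  Submodule.mem_iSup_of_mem p ⟨v, hv, rfl⟩

theorem spread_le {U : Submodule K (Tens K (r + 2) m)}
    (h : ∀ (p : PlacePair m l), ∀ v ∈ S, placeMap K p v ∈ U) : spread q m S ≤ U :=
  iSup_le fun p => Submodule.map_le_iff_le_comap.2 fun v hv => h p v hv

/-- The coordinate at `p` kills the copies of S in other blocks and recovers S from its own copy. So
the spread meets a block with #I = l in exactly the copy of S. -/
theorem coordMap_mem_of_mem_spread (p : PlacePair m l) {v : Tens K (r + 2) m}
    (hv : v ∈ spread q m S) : coordMap K p v ∈ S := by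
  have h : spread q m S ≤ (S.restrictScalars K).comap (coordMap K p) := by
    refine spread_le fun p' w hw => ?_
    show coordMap K p (placeMap K p' w) ∈ S
    by_cases e : p = p'
    · rw [e, coordMap_placeMap]
      exact hw
    · rw [coordMap_placeMap_ne fun h => e (Subtype.ext h)]
      exact S.zero_mem
  exact h hv

theorem coordMap_eq_zero_of_mem_spread {l' : ℕ} (p : PlacePair m l') (hl : l' ≠ l)
    {v : Tens K (r + 2) m} (hv : v ∈ spread q m S) : coordMap K p v = 0 := by
  have h : spread q m S ≤ LinearMap.ker (coordMap K p) := by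
    refine spread_le fun p' w _ => coordMap_placeMap_ne (fun e => hl ?_) w
    rw [← p.2.1, ← p'.2.1, e]
  exact h hv

theorem eq_zero_of_mem_spread {v : Tens K (r + 2) m} (hv : v ∈ spread q m S)
    (h : ∀ p : PlacePair m l, coordMap K p v = 0) : v = 0 := by
  refine eq_zero_of_coordMap fun l' p => ?_
  by_cases e : l' = l
  · subst e
    exact h p
  · exact coordMap_eq_zero_of_mem_spread p e hv

variable (q S)

theorem heckeOp_mem_spread (i : Fin m) :
    ∀ v ∈ spread q m S, heckeOp q i v ∈ spread q m S := by
  have h : spread q m S ≤ (spread q m S).comap (heckeOp q i) := by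
    refine spread_le fun p w hw => ?_
    show heckeOp q i (placeMap K p w) ∈ spread q m S
    rcases heckeOp_placeMap q (r := r) p i with ⟨j, h⟩ | h | ⟨p', c, h⟩
    · rw [h]
      exact placeMap_mem_spread p (heckeOp_mem q S j hw)
    · rw [h]
      exact Submodule.smul_mem _ _ (placeMap_mem_spread p hw)
    · rw [h]
      exact Submodule.add_mem _ (placeMap_mem_spread p' hw)
        (Submodule.smul_mem _ _ (placeMap_mem_spread p hw))
  exact fun v hv => h hv

/-- The operator takes the coordinate at the first `k` places, applies H_σ and reinserts it. That
coordinate is zero for k ≠ l and lies in the submodule S for k = l. -/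
theorem xOp_mem_spread (k : Fin (m + 1)) (σ : Equiv.Perm (Fin k)) :
    ∀ v ∈ spread q m S, xOp q r m σ v ∈ spread q m S := by
  intro v hv
  have hk : (k : ℕ) ≤ m := by omega
  show embTop K r m k ((Psi q (r + 1) k (HeckeB.perm q σ)).unop (projTop K r m k v)) ∈ _
  rw [projTop_eq_coordMap hk, embTop_eq_placeMap hk]
  by_cases e : (k : ℕ) = l
  · subst e
    exact placeMap_mem_spread _
      (S.smul_mem (op (HeckeB.perm q σ)) (coordMap_mem_of_mem_spread _ hv))
  · rw [coordMap_eq_zero_of_mem_spread _ e hv, map_zero, map_zero]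
    exact Submodule.zero_mem _

/-- The sum of the copies of `S` as a module over the duplex Hecke algebra. -/
def spreadModule (m : ℕ) : Submodule (Duplex q m)ᵐᵒᵖ (Tens K (r + 2) m) :=
  { spread q m S with
    smul_mem' := fun a v hv =>
      Xi_mem q (heckeOp_mem_spread q S) (xOp_mem_spread q S) a.unop v hv }

variable {S}

/-- The summand of `D` at `(I, J)` does not depend on the choice of `ω_{I,J}`. -/
theorem summandIJ_eq_map {p : PlacePair m l} {ω : (Duplex q m)ˣ} (hω : IsTransport q r p ω) :
    summandIJ q ω S = (S.restrictScalars K).map (placeMap K p) := by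
  obtain ⟨-, hmap⟩ := hω
  have hl := p.card_le
  rw [tensIJ_eq_range, tensIJ_first hl] at hmap
  apply le_antisymm
  · rintro _ ⟨_, ⟨s, hs, rfl⟩, rfl⟩
    have h1 : embTop K r m l s ∈ spread q m S := by
      rw [embTop_eq_placeMap hl]
      exact placeMap_mem_spread _ hs
    have h2 := (spreadModule q S m).smul_mem (op ((ω⁻¹ : (Duplex q m)ˣ) : Duplex q m)) h1
    rw [duplex_op_smul] at h2
    -- Surjectivity of ω from block to block gives a preimage `u` in the block of `p`; it lies in S
    -- since ω⁻¹ preserves the spread.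
    obtain ⟨_, ⟨u, rfl⟩, hu⟩ := hmap.symm ▸ LinearMap.mem_range_self (embTop K r m l) s
    rw [← hu, Xi_inv_apply] at h2 ⊢
    have h3 := coordMap_mem_of_mem_spread p h2
    rw [coordMap_placeMap] at h3
    exact ⟨u, h3, rfl⟩
  · rintro _ ⟨s, hs, rfl⟩
    have h2 := (spreadModule q S m).smul_mem (op (ω : Duplex q m)) (placeMap_mem_spread p hs)
    rw [duplex_op_smul] at h2
    -- Conversely ω sends the copy at `p` into the first block and keeps it in the spread, hence
    -- into the copy of S there.
    obtain ⟨u, hu⟩ := hmap ▸ Submodule.mem_map_of_mem (LinearMap.mem_range_self (placeMap K p) s)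
    rw [← hu, embTop_eq_placeMap hl] at h2
    have h3 := coordMap_mem_of_mem_spread (PlacePair.first hl) h2
    rw [coordMap_placeMap] at h3
    exact ⟨_, ⟨u, h3, rfl⟩, by rw [hu, Xi_inv_apply]⟩

theorem sumIJ_eq_spread {ω : PlacePair m l → (Duplex q m)ˣ}
    (hω : ∀ p, IsTransport q r p (ω p)) : sumIJ q ω S = spread q m S :=
  iSup_congr fun p => summandIJ_eq_map q (hω p)

theorem iSupIndep_map_placeMap (U : Submodule K (Tens K (r + 1) l)) :
    iSupIndep fun p : PlacePair m l => U.map (placeMap K p) := by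
  intro p
  rw [Submodule.disjoint_def]
  rintro _ ⟨u, -, rfl⟩ h
  have hle : ⨆ (p' : PlacePair m l) (_ : p' ≠ p), U.map (placeMap K p') ≤
      LinearMap.ker (coordMap K p) := by
    refine iSup₂_le fun p' hp' => Submodule.map_le_iff_le_comap.2 fun w _ => ?_
    exact coordMap_placeMap_ne (fun e => hp' (Subtype.ext e).symm) w
  have h2 := hle h
  rw [LinearMap.mem_ker, coordMap_placeMap] at h2
  rw [h2, map_zero]

theorem HeckeB.perm_one : HeckeB.perm q (1 : Equiv.Perm (Fin l)) = 1 := by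
  rw [HeckeB.perm_eq q (w := []) ⟨by simp, by simp [len_one]⟩]
  simp

/-- A subspace closed under the Hecke generators that contains `V^{⊗l} ⊗ η_{r+3/2}^{⊗(m-l)}`
contains all `V̲_{I,J}^{⊗m}` with `#I = l`. -/
theorem placeMap_mem_of_embTop_mem {U : Submodule K (Tens K (r + 2) m)}
    (hT : ∀ i : Fin m, ∀ v ∈ U, heckeOp q i v ∈ U) (p : PlacePair m l) {v : Tens K (r + 1) l}
    (hv : embTop K r m l v ∈ U) : placeMap K p v ∈ U := by
  obtain ⟨ω, hω, h⟩ := linked_first q (r := r) p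
  rw [embTop_eq_placeMap p.card_le, ← h] at hv
  have := (Xi_mem_of_mem_groupT q hT hω _ hv).2
  rwa [Xi_inv_apply] at this

theorem heckeOp_mem_duplex (N : Submodule (Duplex q m)ᵐᵒᵖ (Tens K (r + 2) m)) (i : Fin m)
    {v : Tens K (r + 2) m} (hv : v ∈ N) : heckeOp q i v ∈ N := by
  have h := N.smul_mem (op (Duplex.T q i)) hv
  rwa [duplex_op_smul, Xi_T] at h

/-- The element x_1^{(l)} acts as the projection to the block of the first `l` places, since H_1 is
the identity. This is what the x_σ^{(l)} contribute to simplicity. -/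
theorem embTop_coordMap_mem (hl : l ≤ m) (N : Submodule (Duplex q m)ᵐᵒᵖ (Tens K (r + 2) m))
    {v : Tens K (r + 2) m} (hv : v ∈ N) :
    embTop K r m l (coordMap K (PlacePair.first hl) v) ∈ N := by
  have h := N.smul_mem (op (Duplex.x q (⟨l, by omega⟩ : Fin (m + 1)) 1)) hv
  rw [duplex_op_smul, Xi_x, unop_op, xOp, topOp] at h
  simp only [HeckeB.perm_one] at h
  rw [map_one, unop_one, LinearMap.comp_apply, LinearMap.comp_apply, Module.End.one_apply,
    projTop_eq_coordMap hl] at h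
  exact h

/-- A nonzero submodule must have a nonzero coordinate in the first block, by self-adjointness of
the T_i. Projecting there reduces the question to the simplicity of S, and transport returns to all
blocks. -/
theorem isSimpleModule_spreadModule (hl : l ≤ m)
    (hS : IsSimpleModule (HeckeB q l)ᵐᵒᵖ S) :
    IsSimpleModule (Duplex q m)ᵐᵒᵖ (spreadModule q S m) := by
  rw [isSimpleModule_iff_isAtom] at hS ⊢
  constructor
  · intro h
    apply hS.1
    rw [eq_bot_iff]
    intro s hs
    have h1 : placeMap K (PlacePair.first hl) s ∈ spreadModule q S m := placeMap_mem_spread _ hs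
    rw [h, Submodule.mem_bot] at h1
    rw [Submodule.mem_bot, ← coordMap_placeMap (PlacePair.first hl) s, h1, map_zero]
  · intro N hN
    by_contra hne
    apply hN.not_ge
    obtain ⟨n, hn, hn0⟩ : ∃ n ∈ N, coordMap K (PlacePair.first hl) n ≠ 0 := by
      by_contra! hc
      apply hne
      rw [eq_bot_iff]
      intro v hv
      -- If `N` had no coordinate in the first block, its complement would contain that block and,
      -- being stable under the T_i, all blocks with #I = l. Then every coordinate of a vector of
      -- `N` would vanish.
      have hT : ∀ i : Fin m, ∀ w ∈ (tensForm K (r + 2) m).orthogonal (N.restrictScalars K),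
          heckeOp q i w ∈ (tensForm K (r + 2) m).orthogonal (N.restrictScalars K) := by
        intro i w hw n hn
        show tensForm K (r + 2) m n (heckeOp q i w) = 0
        rw [← tensForm_heckeOp]
        exact hw _ (heckeOp_mem_duplex q N i hn)
      refine eq_zero_of_mem_spread (hN.le hv) fun p =>
        (tensBasis K (r + 1) l).ext_elem fun g => ?_
      have h1 : placeMap K p (tensBasis K (r + 1) l g) ∈
          (tensForm K (r + 2) m).orthogonal (N.restrictScalars K) := by
        refine placeMap_mem_of_embTop_mem q hT p fun n hn => ?_
        show tensForm K (r + 2) m n _ = 0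
        rw [embTop_eq_placeMap hl, tensForm_placeMap, hc n hn, map_zero, LinearMap.zero_apply]
      have h2 : tensForm K (r + 2) m v (placeMap K p (tensBasis K (r + 1) l g)) = 0 := h1 v hv
      rw [tensForm_placeMap, tensForm_basis_right] at h2
      rw [h2]
      simp
    -- The trace of `N` on the first block. It is a Hecke submodule because T_j acts there as H_j
    -- for j < l; it shares with S the nonzero coordinate of `n`, so it contains S.
    let P : Submodule (HeckeB q l)ᵐᵒᵖ (Tens K (r + 1) l) :=
      heckeSubmodule q ((N.restrictScalars K).comap (embTop K r m l)) fun j v hv => by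
        show embTop K r m l (heckeOp q j v) ∈ N
        rw [← heckeOp_embTop q hl]
        exact heckeOp_mem_duplex q N _ hv
    have hP : S ≤ P := by
      refine (hS.not_disjoint_iff_le).1 fun hd => hn0 ?_
      exact Submodule.disjoint_def.1 hd _ (coordMap_mem_of_mem_spread _ (hN.le hn))
        (embTop_coordMap_mem q hl N hn)
    exact spread_le (U := N.restrictScalars K) fun p v hv =>
      placeMap_mem_of_embTop_mem q (fun i v hv => heckeOp_mem_duplex q N i hv) p (hP hv)

/-- Both halves are checked block by block: coordinates carry over the independence of the S^π, and
each basis word is a copy of a word in V^{⊗l}, which is the sum of the S^π. -/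
theorem isSimpleDecomposition_spreadModule {ι : Fin (m + 1) → Type*}
    {S : ∀ l : Fin (m + 1), ι l → Submodule (HeckeB q (l : ℕ))ᵐᵒᵖ (Tens K (r + 1) (l : ℕ))}
    (hS : ∀ l : Fin (m + 1), IsSimpleDecomposition (S l)) :
    IsSimpleDecomposition fun x : Σ l : Fin (m + 1), ι l => spreadModule q (S x.1 x.2) m := by
  refine ⟨?_, ?_, fun x => isSimpleModule_spreadModule q (by omega) ((hS x.1).2.2 x.2)⟩
  · rintro ⟨l, π⟩
    rw [Submodule.disjoint_def]
    intro v hv hv'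
    refine eq_zero_of_mem_spread hv fun p => ?_
    refine Submodule.disjoint_def.1 ((hS l).1 π) _ (coordMap_mem_of_mem_spread p hv) ?_
    set A := ⨆ (π' : ι l) (_ : π' ≠ π), S l π'
    -- Modules with the same `l` have coordinates in their own S^{π'}, π' ≠ π; modules with another
    -- `l` have coordinate zero.
    have hle : (⨆ (y : Σ l : Fin (m + 1), ι l) (_ : y ≠ ⟨l, π⟩),
        spreadModule q (S y.1 y.2) m).restrictScalars K ≤
        (A.restrictScalars K).comap (coordMap K p) := by
      simp only [Submodule.restrictScalars_iSup]
      refine iSup₂_le ?_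
      rintro ⟨l', π'⟩ hne w hw
      by_cases e : l' = l
      · subst e
        have hne' : π' ≠ π := fun h => hne (by rw [h])
        exact (le_iSup₂ (f := fun (π' : ι l') (_ : π' ≠ π) => S l' π') π' hne')
          (coordMap_mem_of_mem_spread p hw)
      · show coordMap K p w ∈ A
        rw [coordMap_eq_zero_of_mem_spread p (fun h => e (Fin.ext h.symm)) hw]
        exact Submodule.zero_mem _
    exact hle hv'
  · set W := ⨆ x : Σ l : Fin (m + 1), ι l, spreadModule q (S x.1 x.2) m
    rw [eq_top_iff]
    suffices h : ⊤ ≤ W.restrictScalars K from fun v hv => h hv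
    rw [← (tensBasis K (r + 2) m).span_eq, Submodule.span_le]
    rintro _ ⟨f, rfl⟩
    obtain ⟨l, p, g, rfl⟩ := PlacePair.exists_place f
    obtain ⟨l, rfl⟩ : ∃ l' : Fin (m + 1), (l' : ℕ) = l := ⟨⟨l, by have := p.card_le; omega⟩, rfl⟩
    have hle : ((⨆ π, S l π).restrictScalars K) ≤
        (W.restrictScalars K).comap (placeMap K p) := by
      rw [Submodule.restrictScalars_iSup]
      refine iSup_le fun π w hw => ?_
      exact (le_iSup (fun x : Σ l : Fin (m + 1), ι l => spreadModule q (S x.1 x.2) m) ⟨l, π⟩)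
        (placeMap_mem_spread p hw)
    rw [← placeMap_basis]
    refine hle ?_
    rw [(hS l).2.1]
    exact Submodule.mem_top

end Summand

end

end DuplexB

theorem corollary3p4 {K : Type*} [Field K] [CharZero K] (q : Kˣ)
    (hq : Transcendental ℚ (q : K)) (hK : IntermediateField.adjoin ℚ {(q : K)} = ⊤)
    (r m : ℕ) (hr : 1 ≤ r) (hm : 2 ≤ m) :
    -- complete reducibility of the right module
    IsSemisimpleModule (Duplex q m)ᵐᵒᵖ (Tens K (r + 2) m) ∧
    -- the decompositions of the tensor powers of `V` and the elements `ω_{I,J}` exist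
    (∀ l : Fin (m + 1), ∃ (n : ℕ)
      (S : Fin n → Submodule (HeckeB q (l : ℕ))ᵐᵒᵖ (Tens K (r + 1) (l : ℕ))),
      IsSimpleDecomposition S) ∧
    (∀ (l : Fin (m + 1)) (p : PlacePair m l), ∃ ω : (Duplex q m)ˣ, IsTransport q r p ω) ∧
    -- for any choice of them the modules `D^π_l` are simple, and their direct sum is everything
    ∀ (ι : Fin (m + 1) → Type*)
      (S : ∀ l : Fin (m + 1), ι l →
        Submodule (HeckeB q (l : ℕ))ᵐᵒᵖ (Tens K (r + 1) (l : ℕ)))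
      (ω : ∀ l : Fin (m + 1), PlacePair m l → (Duplex q m)ˣ),
      (∀ l : Fin (m + 1), IsSimpleDecomposition (S l)) →
      (∀ (l : Fin (m + 1)) (p : PlacePair m l), IsTransport q r p (ω l p)) →
      (∀ (l : Fin (m + 1)) (π : ι l), iSupIndep fun p : PlacePair m l =>
        summandIJ q (ω l p) (S l π)) ∧
      ∃ D : (Σ l : Fin (m + 1), ι l) → Submodule (Duplex q m)ᵐᵒᵖ (Tens K (r + 2) m),
        (∀ (l : Fin (m + 1)) (π : ι l), (D ⟨l, π⟩).restrictScalars K = sumIJ q (ω l) (S l π)) ∧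
        IsSimpleDecomposition D := by
  obtain ⟨φ⟩ := exists_ringHom_real hq hK
  have hdec := fun l : Fin (m + 1) => exists_isSimpleDecomposition_hecke q φ (r + 1) l
  refine ⟨?_, hdec, fun l p => exists_isTransport q r p, fun ι S ω hS hω => ⟨fun l π => ?_, ?_⟩⟩
  -- Complete reducibility needs only one family of decompositions of the V^{⊗l}: a sum of simple
  -- submodules is semisimple.
  · choose n S hS using hdec
    obtain ⟨-, htop, hsimple⟩ := isSimpleDecomposition_spreadModule q hS
    exact isSemisimpleModule_of_isSemisimpleModule_submodule'
      (fun x => have := hsimple x; inferInstance) htop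
  -- The given ω disappear here, since each summand equals the standard copy of S in its block.
  · simp only [summandIJ_eq_map q (hω l _)]
    exact iSupIndep_map_placeMap _
  · exact ⟨fun x => spreadModule q (S x.1 x.2) m,
      fun l π => (sumIJ_eq_spread q (hω l)).symm ▸ rfl, isSimpleDecomposition_spreadModule q hS⟩
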